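/- **Theorem.** Let $(M,g)$ be a smooth complete Riemannian manifold, let $N$ be a smooth manifold and let $f:M\to N$ be a smooth map. Let $$U=\{x\in M : \operatorname{rank}(df_x)\ge \operatorname{rank}(df_y)\ \text{ for all } y\in M\}$$ be the (open) set of points at which the rank of $f$ is maximal. Assume that the distribution $\ker(df)|_U$ is autoparallel, that is, $\nabla_XY$ is a section of $\ker(df)$ whenever $X$ and $Y$ are smooth sections of $\ker(df)$ over an open subset of $U$, where $\nabla$ is the Levi-Civita connection of $g$. Then every maximal integral manifold of $\ker(df)|_U$ is a complete Riemannian manifold with respect to the metric induced by $g$. Here an integral manifold of $\ker(df)|_U$ is a connected manifold $L$ with an injective smooth immersion $j:L\to M$ such that $j(L)\subseteq U$ and $dj_q(T_qL)=\ker(df_{j(q)})$ for all $q\in L$; it is maximal if its image is not properly contained in the image of another integral manifold. A Riemannian manifold is complete if for every tangent vector $v$ there is a geodesic defined on all of $\mathbb{R}$ with initial velocity $v$. -/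

import Mathlib

open scoped Manifold ContDiff Bundle

universe u v

noncomputable section

namespace KernelFoliation

/-- The pullback `(v, w) ↦ B (A v) (A w)` of a bilinear form `B` under a linear map `A`. -/
def pullbackForm {V W : Type*} [AddCommGroup V] [Module ℝ V] [TopologicalSpace V]
    [AddCommGroup W] [Module ℝ W] [TopologicalSpace W]
    (B : W →L[ℝ] W →L[ℝ] ℝ) (A : V →L[ℝ] W) : V →L[ℝ] V →L[ℝ] ℝ :=
  (ContinuousLinearMap.precomp ℝ A).comp (B.comp A)

section LeviCivita

variable {E : Type*} [NormedAddCommGroup E] [NormedSpace ℝ E]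
  {M : Type*} [TopologicalSpace M] [ChartedSpace E M]

/-- The coordinate expression, in the chart around `x₀`, of a field `g` of bilinear forms on the
tangent spaces: the pullback of `g` under the inverse of the chart. -/
def formInChart (g : ∀ x : M, TangentSpace 𝓘(ℝ, E) x →L[ℝ] TangentSpace 𝓘(ℝ, E) x →L[ℝ] ℝ)
    (x₀ : M) (y : E) : E →L[ℝ] E →L[ℝ] ℝ :=
  pullbackForm (g ((extChartAt 𝓘(ℝ, E) x₀).symm y))
    (mfderiv 𝓘(ℝ, E) 𝓘(ℝ, E) (extChartAt 𝓘(ℝ, E) x₀).symm y)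

/-- The coordinate expression of a vector field in the chart around `x₀`. -/
def fieldInChart (X : ∀ x : M, TangentSpace 𝓘(ℝ, E) x) (x₀ : M) (y : E) : E :=
  mfderiv 𝓘(ℝ, E) 𝓘(ℝ, E) (extChartAt 𝓘(ℝ, E) x₀) ((extChartAt 𝓘(ℝ, E) x₀).symm y)
    (X ((extChartAt 𝓘(ℝ, E) x₀).symm y))

/-- The Christoffel symbol of the first kind in the chart around `x₀`: with `G` the coordinate
expression of the metric, it is the linear form
`w ↦ (D_v G (v', w) + D_{v'} G (v, w) - D_w G (v, v')) / 2`. -/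
def christoffelFirst
    (g : ∀ x : M, TangentSpace 𝓘(ℝ, E) x →L[ℝ] TangentSpace 𝓘(ℝ, E) x →L[ℝ] ℝ)
    (x₀ : M) (y v v' : E) : E →L[ℝ] ℝ :=
  (1 / 2 : ℝ) • (fderiv ℝ (formInChart g x₀) y v v' + fderiv ℝ (formInChart g x₀) y v' v
    - ((fderiv ℝ (formInChart g x₀) y).flip v).flip v')

/-- The Christoffel symbol (of the second kind) `Γ(v, v')` of the Levi-Civita connection of the
metric `g` in the chart around `x₀`, at the point with coordinates `y`: the vector that represents
the form `christoffelFirst g x₀ y v v'` with respect to the metric. -/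
def christoffel
    (g : ∀ x : M, TangentSpace 𝓘(ℝ, E) x →L[ℝ] TangentSpace 𝓘(ℝ, E) x →L[ℝ] ℝ)
    (x₀ : M) (y v v' : E) : E :=
  (formInChart g x₀ y).inverse (christoffelFirst g x₀ y v v')

/-- The Levi-Civita covariant derivative `(∇_X Y)(p)`, computed in the chart around `p` as
`DY (X) + Γ(X, Y)`. -/
def leviCivita
    (g : ∀ x : M, TangentSpace 𝓘(ℝ, E) x →L[ℝ] TangentSpace 𝓘(ℝ, E) x →L[ℝ] ℝ)
    (X Y : ∀ x : M, TangentSpace 𝓘(ℝ, E) x) (p : M) : TangentSpace 𝓘(ℝ, E) p :=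
  let y : E := extChartAt 𝓘(ℝ, E) p p
  mfderiv 𝓘(ℝ, E) 𝓘(ℝ, E) (extChartAt 𝓘(ℝ, E) p).symm y
    (fderiv ℝ (fieldInChart Y p) y (fieldInChart X p y)
      + christoffel g p y (fieldInChart X p y) (fieldInChart Y p y))

/-- `γ : ℝ → M` is a (complete) geodesic of the metric `g`: it is smooth, and `∇_{γ'} γ' = 0`,
i.e. the geodesic equation `c'' + Γ(c', c') = 0` holds in all charts. -/
structure IsGeodesic
    (g : ∀ x : M, TangentSpace 𝓘(ℝ, E) x →L[ℝ] TangentSpace 𝓘(ℝ, E) x →L[ℝ] ℝ)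
    (γ : ℝ → M) : Prop where
  contMDiff : ContMDiff 𝓘(ℝ, ℝ) 𝓘(ℝ, E) ∞ γ
  equation : ∀ (x₀ : M) (t : ℝ), γ t ∈ (extChartAt 𝓘(ℝ, E) x₀).source →
    deriv (deriv (fun s ↦ extChartAt 𝓘(ℝ, E) x₀ (γ s))) t
      + christoffel g x₀ (extChartAt 𝓘(ℝ, E) x₀ (γ t))
        (deriv (fun s ↦ extChartAt 𝓘(ℝ, E) x₀ (γ s)) t)
        (deriv (fun s ↦ extChartAt 𝓘(ℝ, E) x₀ (γ s)) t) = 0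

/-- Completeness of a Riemannian manifold: for each tangent vector `v`, the geodesic with initial
velocity `v` is defined on all of `ℝ`. -/
def IsCompleteMetric
    (g : ∀ x : M, TangentSpace 𝓘(ℝ, E) x →L[ℝ] TangentSpace 𝓘(ℝ, E) x →L[ℝ] ℝ) : Prop :=
  ∀ v : TangentBundle 𝓘(ℝ, E) M, ∃ γ : ℝ → M, IsGeodesic g γ ∧
    tangentMap 𝓘(ℝ, ℝ) 𝓘(ℝ, E) γ ⟨0, (1 : ℝ)⟩ = v

/-- The distribution `D` is autoparallel on the open set `U`: for all smooth sections `X`, `Y` of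
`D` over an open subset of `U`, the vector field `∇_X Y` is a section of `D` as well. -/
def IsAutoparallelOn [IsManifold 𝓘(ℝ, E) ∞ M]
    (g : ∀ x : M, TangentSpace 𝓘(ℝ, E) x →L[ℝ] TangentSpace 𝓘(ℝ, E) x →L[ℝ] ℝ)
    (D : ∀ x : M, Submodule ℝ (TangentSpace 𝓘(ℝ, E) x)) (U : Set M) : Prop :=
  ∀ (V : Set M), IsOpen V → V ⊆ U → ∀ X Y : ∀ x : M, TangentSpace 𝓘(ℝ, E) x,
    ContMDiffOn 𝓘(ℝ, E) 𝓘(ℝ, E).tangent ∞ (fun x ↦ (⟨x, X x⟩ : TangentBundle 𝓘(ℝ, E) M)) V →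
    ContMDiffOn 𝓘(ℝ, E) 𝓘(ℝ, E).tangent ∞ (fun x ↦ (⟨x, Y x⟩ : TangentBundle 𝓘(ℝ, E) M)) V →
    (∀ x ∈ V, X x ∈ D x) → (∀ x ∈ V, Y x ∈ D x) →
    ∀ x ∈ V, leviCivita g X Y x ∈ D x

end LeviCivita

section Kernel

variable (E : Type*) [NormedAddCommGroup E] [NormedSpace ℝ E]
  {M : Type*} [TopologicalSpace M] [ChartedSpace E M]
  (F : Type*) [NormedAddCommGroup F] [NormedSpace ℝ F]
  {N : Type*} [TopologicalSpace N] [ChartedSpace F N]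

/-- The rank of `f` at `x`, i.e. the rank of its differential at `x`. -/
def rankAt (f : M → N) (x : M) : ℕ :=
  Module.finrank ℝ (mfderiv 𝓘(ℝ, E) 𝓘(ℝ, F) f x).range

/-- The set of points at which the rank of `f` is maximal. -/
def maxRankSet (f : M → N) : Set M :=
  {x | ∀ y, rankAt E F f y ≤ rankAt E F f x}

/-- The field of kernels `ker (df)`. -/
def kerDistribution (f : M → N) (x : M) : Submodule ℝ (TangentSpace 𝓘(ℝ, E) x) :=
  (mfderiv 𝓘(ℝ, E) 𝓘(ℝ, F) f x).ker

end Kernel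

section IntegralManifold

variable {E : Type*} [NormedAddCommGroup E] [NormedSpace ℝ E]
  {M : Type u} [TopologicalSpace M] [ChartedSpace E M]
  (K : Type*) [NormedAddCommGroup K] [NormedSpace ℝ K]

/-- The injective immersion `j : L → M` of a connected manifold `L` is an integral manifold of the
distribution `D` on `U`. -/
structure IsIntegralManifold (D : ∀ x : M, Submodule ℝ (TangentSpace 𝓘(ℝ, E) x)) (U : Set M)
    {L : Type u} [TopologicalSpace L] [ChartedSpace K L] (j : L → M) : Prop where
  connected : ConnectedSpace L
  contMDiff : ContMDiff 𝓘(ℝ, K) 𝓘(ℝ, E) ∞ j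
  injective : Function.Injective j
  injective_mfderiv : ∀ q, Function.Injective (mfderiv 𝓘(ℝ, K) 𝓘(ℝ, E) j q)
  mem : ∀ q, j q ∈ U
  range_mfderiv : ∀ q, (mfderiv 𝓘(ℝ, K) 𝓘(ℝ, E) j q).range = D (j q)

/-- An integral manifold is maximal if it is not properly contained in another (connected)
integral manifold. -/
def IsMaximalIntegralManifold (D : ∀ x : M, Submodule ℝ (TangentSpace 𝓘(ℝ, E) x)) (U : Set M)
    {L : Type u} [TopologicalSpace L] [ChartedSpace K L] (j : L → M) : Prop :=
  IsIntegralManifold K D U j ∧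
    ∀ (L' : Type u) [TopologicalSpace L'] [ChartedSpace K L'] [IsManifold 𝓘(ℝ, K) ∞ L']
      (j' : L' → M), IsIntegralManifold K D U j' →
      Set.range j ⊆ Set.range j' → Set.range j' = Set.range j

/-- The metric that `j : L → M` induces on `L`. -/
def inducedMetric (g : ∀ x : M, TangentSpace 𝓘(ℝ, E) x →L[ℝ] TangentSpace 𝓘(ℝ, E) x →L[ℝ] ℝ)
    {L : Type u} [TopologicalSpace L] [ChartedSpace K L] (j : L → M) (q : L) :
    TangentSpace 𝓘(ℝ, K) q →L[ℝ] TangentSpace 𝓘(ℝ, K) q →L[ℝ] ℝ :=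
  pullbackForm (g (j q)) (mfderiv 𝓘(ℝ, K) 𝓘(ℝ, E) j q)

end IntegralManifold

end KernelFoliation

end

/-! A geodesic `γ` of `M` that starts tangent to a leaf stays in the leaf for all time. Its
acceleration vanishes, hence so does the part tangent to the leaf, and it is a geodesic of the leaf.
The main point is that the set of times `t` with `γ t ∈ U` and `(f ∘ γ)'(t) = 0` is open and closed.

Open: for sections `X`, `Y` of `ker df` one has `Hess f (X, Y) = -df (∇_X Y)`, so autoparallelism
says that the Hessian, in coordinates on `N`, vanishes on pairs of kernel vectors
(`hessianAt_eq_zero_of_isAutoparallelOn`). Where the rank is maximal this gives `Hess f (v, v) = B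
(df v)` with `B` of class C¹ in `v` and its base point (`exists_hessianAt_eq`). Along a geodesic `df
(γ')` then solves the linear equation `x' = B x`, so it vanishes near each of its zeros.

Closed: the danger is a drop of the rank at a limit time `b`, excluded by
`finrank_range_eq_of_eventually_left`. At a time `a < b` and for any `w₀`, choose a Jacobi field `J`
with `J a = w₀` that is, to first order, a variation through geodesics tangent to `ker df`.
Linearizing the equation above shows that this property persists up to `b`, and it makes `df (J)`
constant. Since `J` solves a linear equation with continuous coefficients across `b`, continuity
gives `df (J b) = df (w₀)`. So the range of `df` at `b` is at least as large as at `a`.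

Thus `γ` stays in `U` and in one fiber of `f`. By the constant rank theorem the components of `U ∩
f⁻¹(c)` are integral manifolds, so a maximal leaf is a whole component
(`range_eq_connectedComponentIn`), and it contains the connected curve `γ`. The lift to the leaf is
smooth by `exists_local_inverse`, and a geodesic by the Gauss formula
`christoffelFirst_inducedMetric`. -/

noncomputable section

namespace KernelFoliation

set_option maxSynthPendingDepth 3

open Set Filter Topology

/-! ### Families of linear maps of constant rank -/

section LinearAlgebra

variable {E F : Type*} [NormedAddCommGroup E] [NormedSpace ℝ E]
  [NormedAddCommGroup F] [NormedSpace ℝ F]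

/-- Every linear map between finite-dimensional spaces has a generalized inverse. -/
lemma exists_generalized_inverse [FiniteDimensional ℝ F] (A : E →L[ℝ] F) :
    ∃ R : F →L[ℝ] E, ∀ x, A (R (A x)) = A x := by
  obtain ⟨s, hs⟩ := (A : E →ₗ[ℝ] F).rangeRestrict.exists_rightInverse_of_surjective
    (LinearMap.range_rangeRestrict _)
  obtain ⟨q, hq⟩ := (LinearMap.range (A : E →ₗ[ℝ] F)).subtype.exists_leftInverse_of_injective
    (Submodule.ker_subtype _)
  have h1 : ∀ y, A (s y) = y := fun y ↦ congrArg Subtype.val (LinearMap.congr_fun hs y)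
  have h2 : ∀ y : LinearMap.range (A : E →ₗ[ℝ] F), q y = y := fun y ↦ LinearMap.congr_fun hq y
  -- Project `F` to the range of `A` by `q`, then lift by the section `s`.
  refine ⟨LinearMap.toContinuousLinearMap (s ∘ₗ q), fun x ↦ ?_⟩
  have := h2 ⟨A x, ⟨x, rfl⟩⟩
  simp only [LinearMap.coe_toContinuousLinearMap', LinearMap.comp_apply]
  rw [h1]
  exact congrArg Subtype.val this

/-- The perturbation `R A + (1 - R A₀)` of the identity. -/
def splitMap (A₀ : E →L[ℝ] F) (R : F →L[ℝ] E) (A : E →L[ℝ] F) : E →L[ℝ] E :=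
  R ∘L A + (ContinuousLinearMap.id ℝ E - R ∘L A₀)

lemma splitMap_apply (A₀ : E →L[ℝ] F) (R : F →L[ℝ] E) (A : E →L[ℝ] F) (x : E) :
    splitMap A₀ R A x = R (A x) + (x - R (A₀ x)) := rfl

lemma splitMap_self (A₀ : E →L[ℝ] F) (R : F →L[ℝ] E) :
    splitMap A₀ R A₀ = ContinuousLinearMap.id ℝ E := by
  ext x; simp [splitMap_apply]

variable {A₀ A : E →L[ℝ] F} {R : F →L[ℝ] E}

/-- On `ker A` the map is `x ↦ x - R A₀ x`, and `A₀ R A₀ = A₀`. -/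
lemma apply_splitMap_of_ker (hR : ∀ x, A₀ (R (A₀ x)) = A₀ x) {x : E} (hx : A x = 0) :
    A₀ (splitMap A₀ R A x) = 0 := by
  simp [splitMap_apply, hx, hR]

/-- `splitMap A₀ R A` restricts to an injection of `ker A` into `ker A₀`. -/
lemma finrank_ker_le_of_splitMap [FiniteDimensional ℝ E] (hR : ∀ x, A₀ (R (A₀ x)) = A₀ x)
    (hT : Function.Injective (splitMap A₀ R A)) :
    Module.finrank ℝ A.ker ≤ Module.finrank ℝ A₀.ker := by
  let φ : A.ker →ₗ[ℝ] A₀.ker :=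
    ((splitMap A₀ R A : E →ₗ[ℝ] E).comp A.ker.subtype).codRestrict A₀.ker
      (fun x ↦ apply_splitMap_of_ker hR x.2)
  refine LinearMap.finrank_le_finrank_of_injective (f := φ) fun x y hxy ↦ ?_
  exact Subtype.ext (hT (congrArg Subtype.val hxy))

lemma finrank_range_add_finrank_ker' [FiniteDimensional ℝ E] (A : E →L[ℝ] F) :
    Module.finrank ℝ A.range + Module.finrank ℝ A.ker = Module.finrank ℝ E :=
  LinearMap.finrank_range_add_finrank_ker (A : E →ₗ[ℝ] F)

lemma finrank_range_le_of_splitMap [FiniteDimensional ℝ E] (hR : ∀ x, A₀ (R (A₀ x)) = A₀ x)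
    (hT : Function.Injective (splitMap A₀ R A)) :
    Module.finrank ℝ A₀.range ≤ Module.finrank ℝ A.range := by
  have h := finrank_ker_le_of_splitMap hR hT
  have h1 := finrank_range_add_finrank_ker' A
  have h2 := finrank_range_add_finrank_ker' A₀
  omega

/-- If `A` has at most the rank of `A₀`, then `splitMap A₀ R A` maps `ker A` onto `ker A₀`. -/
lemma apply_eq_zero_of_apply_splitMap_eq_zero [FiniteDimensional ℝ E] (hR : ∀ x, A₀ (R (A₀ x)) = A₀ x)
    (hT : Function.Injective (splitMap A₀ R A))
    (hrank : Module.finrank ℝ A.range ≤ Module.finrank ℝ A₀.range) {x : E}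
    (hx : A₀ (splitMap A₀ R A x) = 0) : A x = 0 := by
  let φ : A.ker →ₗ[ℝ] A₀.ker :=
    ((splitMap A₀ R A : E →ₗ[ℝ] E).comp A.ker.subtype).codRestrict A₀.ker
      (fun x ↦ apply_splitMap_of_ker hR x.2)
  have hφ : Function.Injective φ := fun x y hxy ↦
    Subtype.ext (hT (congrArg Subtype.val hxy))
  have h := finrank_ker_le_of_splitMap hR hT
  have h1 := finrank_range_add_finrank_ker' A
  have h2 := finrank_range_add_finrank_ker' A₀
  have hd : Module.finrank ℝ A.ker = Module.finrank ℝ A₀.ker := by omega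
  obtain ⟨y, hy⟩ := (LinearMap.injective_iff_surjective_of_finrank_eq_finrank hd).1 hφ
    ⟨splitMap A₀ R A x, hx⟩
  have : (y : E) = x := hT (congrArg Subtype.val hy)
  rw [← this]
  exact y.2

/-- Near a parameter `x₀`, a family `A` of linear maps of constant rank admits families of
projections `P` to the kernels and of generalized inverses `R` that are as smooth as `A`. -/
lemma exists_kernel_splitting [FiniteDimensional ℝ E] [FiniteDimensional ℝ F] {X : Type*}
    [NormedAddCommGroup X] [NormedSpace ℝ X] {A : X → E →L[ℝ] F} {x₀ : X}
    (hA : ContinuousAt A x₀) :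
    ∃ (P : X → E →L[ℝ] E) (R : X → F →L[ℝ] E), ∀ᶠ x in 𝓝 x₀,
      (ContDiffAt ℝ ∞ A x → ContDiffAt ℝ ∞ P x ∧ ContDiffAt ℝ ∞ R x) ∧
        (∀ u, P x u + R x (A x u) = u) ∧
        Module.finrank ℝ (A x₀).range ≤ Module.finrank ℝ (A x).range ∧
        (Module.finrank ℝ (A x).range ≤ Module.finrank ℝ (A x₀).range → ∀ u, A x (P x u) = 0) := by
  obtain ⟨R, hR⟩ := exists_generalized_inverse (A x₀)
  set T : X → E →L[ℝ] E := fun x ↦ splitMap (A x₀) R (A x) with hTdef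
  have hTc : ContinuousAt T x₀ := (continuousAt_const.clm_comp hA).add continuousAt_const
  have hT0 : T x₀ = ((ContinuousLinearEquiv.refl ℝ E : E ≃L[ℝ] E) : E →L[ℝ] E) :=
    splitMap_self _ _
  have hev : ∀ᶠ x in 𝓝 x₀, (T x).IsInvertible := by
    have : range ((↑) : (E ≃L[ℝ] E) → E →L[ℝ] E) ∈ 𝓝 (T x₀) := by
      rw [hT0]; exact ContinuousLinearEquiv.nhds _
    filter_upwards [hTc this] with x hx
    exact hx
  -- Applying `T⁻¹` to `T = (1 - R A₀) + R A` splits the identity into `P = T⁻¹ (1 - R A₀)` and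
  -- `(T⁻¹ R) A`. The map `1 - R A₀` takes values in `ker A₀`, and `T⁻¹` carries these back to `ker
  -- A` when the rank has not gone up.
  refine ⟨fun x ↦ (T x).inverse ∘L (ContinuousLinearMap.id ℝ E - R ∘L A x₀),
    fun x ↦ (T x).inverse ∘L R, ?_⟩
  filter_upwards [hev] with x hx
  have hS : ContDiffAt ℝ ∞ A x → ContDiffAt ℝ ∞ (fun x ↦ (T x).inverse) x := by
    intro hAx
    have hT : ContDiffAt ℝ ∞ T x := (contDiffAt_const.clm_comp hAx).add contDiffAt_const
    have h : ContDiffAt ℝ ∞ (ContinuousLinearMap.inverse : (E →L[ℝ] E) → E →L[ℝ] E) (T x) := by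
      obtain ⟨e, he⟩ := hx
      rw [← he]
      exact contDiffAt_map_inverse _
    exact h.comp x hT
  have hinj : Function.Injective (T x) := by
    obtain ⟨e, he⟩ := hx
    rw [← he]; exact e.injective
  have hTS : ∀ u, T x ((T x).inverse u) = u := by
    obtain ⟨e, he⟩ := hx
    intro u
    rw [← he]; simp
  refine ⟨fun h ↦ ⟨(hS h).clm_comp contDiffAt_const, (hS h).clm_comp contDiffAt_const⟩,
    fun u ↦ hinj ?_, finrank_range_le_of_splitMap hR hinj, fun hr u ↦ ?_⟩
  · simp only [ContinuousLinearMap.comp_apply, map_add, hTS]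
    simp only [hTdef, splitMap_apply, sub_apply, ContinuousLinearMap.comp_apply,
      ContinuousLinearMap.id_apply]
    abel
  · refine apply_eq_zero_of_apply_splitMap_eq_zero hR hinj hr ?_
    change A x₀ (T x ((T x).inverse _)) = 0
    rw [hTS]
    simp [hR]

end LinearAlgebra

/-- A family of linear maps on a finite-dimensional space is smooth if its values are. -/
lemma contDiffAt_clm_of_apply {X E F : Type*} [NormedAddCommGroup X] [NormedSpace ℝ X]
    [NormedAddCommGroup E] [NormedSpace ℝ E] [FiniteDimensional ℝ E]
    [NormedAddCommGroup F] [NormedSpace ℝ F] {A : X → E →L[ℝ] F} {x : X} {n : WithTop ℕ∞}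
    (h : ∀ u, ContDiffAt ℝ n (fun y ↦ A y u) x) : ContDiffAt ℝ n A x := by
  let e₁ := ContinuousLinearEquiv.ofFinrankEq (Module.finrank_fin_fun ℝ (n := Module.finrank ℝ E)).symm
  let e₂ := (e₁.arrowCongr (1 : F ≃L[ℝ] F)).trans (ContinuousLinearEquiv.piRing _)
  rw [← Function.id_comp A, ← e₂.symm_comp_self]
  exact e₂.symm.contDiff.contDiffAt.comp x (contDiffAt_pi.2 fun i ↦ h _)

/-! ### Linear differential equations and linearized flows -/

section LinearODE

variable {X : Type*} [NormedAddCommGroup X] [NormedSpace ℝ X]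

/-- Solutions of a linear differential equation exist near `b` on an interval that does not depend
on the initial values. -/
lemma exists_forall_hasDerivAt_linear [CompleteSpace X] {A : ℝ → X →L[ℝ] X} {b : ℝ}
    (hA : ∀ᶠ t in 𝓝 b, ContinuousAt A t) :
    ∃ ε > 0, ∀ a ∈ Ioo (b - ε) (b + ε), ∀ x₀ : X, ∃ ζ : ℝ → X, ζ a = x₀ ∧
      ∀ t ∈ Ioo (b - ε) (b + ε), HasDerivAt ζ (A t (ζ t)) t := by
  set K : ℝ := ‖A b‖ + 1 with hK
  have hKpos : 0 < K := by positivity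
  have hbd : ∀ᶠ t in 𝓝 b, ‖A t‖ < K :=
    hA.self_of_nhds.norm.eventually_lt continuousAt_const (by simp [hK])
  obtain ⟨δ, hδ, hball⟩ := Metric.eventually_nhds_iff_ball.1 (hA.and hbd)
  -- Picard–Lindelöf is used on the ball of radius `‖x₀‖` about `x₀`, where the field is bounded by
  -- `2 K ‖x₀‖`, over times at most `2 ε`; this needs `4 K ε ≤ 1`. Scaling the radius with `‖x₀‖` is
  -- what makes `ε` independent of `x₀`. The bound `δ / 2` keeps the closed interval inside the ball
  -- of radius `δ`.
  set ε : ℝ := min (δ / 2) (1 / (4 * K)) with hε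
  have hεpos : 0 < ε := by positivity
  have hε1 : ε ≤ δ / 2 := min_le_left _ _
  have hε2 : 4 * K * ε ≤ 1 := by
    have : ε ≤ 1 / (4 * K) := min_le_right _ _
    rw [le_div_iff₀ (by positivity)] at this
    linarith
  have hmem : ∀ t ∈ Icc (b - ε) (b + ε), ContinuousAt A t ∧ ‖A t‖ < K := by
    intro t ht
    apply hball
    rw [Metric.mem_ball, Real.dist_eq, abs_lt]
    constructor <;> linarith [ht.1, ht.2]
  refine ⟨ε, hεpos, fun a ha x₀ ↦ ?_⟩
  have hpl : IsPicardLindelof (fun t x ↦ A t x) (tmin := b - ε) (tmax := b + ε)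
      ⟨a, Ioo_subset_Icc_self ha⟩ x₀ ‖x₀‖₊ 0 (K.toNNReal * (2 * ‖x₀‖₊)) K.toNNReal := by
    refine ⟨fun t ht ↦ ?_, fun x _ t ht ↦ ?_, fun t ht x hx ↦ ?_, ?_⟩
    · refine ((A t).lipschitz.weaken ?_).lipschitzOnWith
      rw [← NNReal.coe_le_coe, Real.coe_toNNReal _ hKpos.le]
      exact (hmem t ht).2.le
    · exact ((hmem t ht).1.clm_apply continuousAt_const).continuousWithinAt
    · have hx' : ‖x‖ ≤ 2 * ‖x₀‖ := by
        have h1 : ‖x - x₀‖ ≤ ‖x₀‖ := by simpa [dist_eq_norm] using hx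
        have h2 := norm_sub_norm_le x x₀
        linarith
      have := (A t).le_of_opNorm_le (hmem t ht).2.le x
      simp only [NNReal.coe_mul, Real.coe_toNNReal _ hKpos.le, coe_nnnorm, NNReal.coe_ofNat]
      exact this.trans (by gcongr)
    · simp only [NNReal.coe_mul, Real.coe_toNNReal _ hKpos.le, coe_nnnorm, NNReal.coe_ofNat,
        NNReal.coe_zero, sub_zero]
      have h1 : max (b + ε - a) (a - (b - ε)) ≤ 2 * ε := by
        apply max_le <;> linarith [ha.1, ha.2]
      calc K * (2 * ‖x₀‖) * max (b + ε - a) (a - (b - ε)) ≤ K * (2 * ‖x₀‖) * (2 * ε) := by gcongr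
        _ = (4 * K * ε) * ‖x₀‖ := by ring
        _ ≤ 1 * ‖x₀‖ := by gcongr
        _ = ‖x₀‖ := one_mul _
  obtain ⟨ζ, h0, hζ⟩ := hpl.exists_eq_forall_mem_Icc_hasDerivWithinAt₀
  exact ⟨ζ, h0, fun t ht ↦ (hζ t (Ioo_subset_Icc_self ht)).hasDerivAt (Icc_mem_nhds ht.1 ht.2)⟩

/-- Uniqueness against the zero solution: a continuous coefficient is bounded near `t`, so the field
is Lipschitz. -/
lemma eventually_eq_zero_of_linear {B : ℝ → X →L[ℝ] X} {x : ℝ → X} {t : ℝ}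
    (hB : ContinuousAt B t) (hx : ∀ᶠ s in 𝓝 t, HasDerivAt x (B s (x s)) s) (h0 : x t = 0) :
    ∀ᶠ s in 𝓝 t, x s = 0 := by
  have hbd : ∀ᶠ s in 𝓝 t, ‖B s‖ < ‖B t‖ + 1 :=
    hB.norm.eventually_lt continuousAt_const (by simp)
  refine ODE_solution_unique_of_eventually (v := fun s y ↦ B s y) (s := fun _ ↦ univ)
    (K := (‖B t‖ + 1).toNNReal) (g := fun _ ↦ 0) ?_ ?_ ?_ h0
  · filter_upwards [hbd] with s hs
    refine ((B s).lipschitz.weaken ?_).lipschitzOnWith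
    rw [← NNReal.coe_le_coe, Real.coe_toNNReal _ (by positivity)]
    exact hs.le
  · filter_upwards [hx] with s hs using ⟨hs, mem_univ _⟩
  · filter_upwards with s
    refine ⟨?_, mem_univ _⟩
    simpa using hasDerivAt_const s (0 : X)

/-- The zero set is open and closed in the interval. The coefficient `B` may change with `t`,
because the factorization of the Hessian is only local. -/
lemma eq_zero_of_linear {x : ℝ → X} {a b : ℝ}
    (hx : ∀ t ∈ Ioo a b, ∃ B : ℝ → X →L[ℝ] X, ContinuousAt B t ∧
      ∀ᶠ s in 𝓝 t, HasDerivAt x (B s (x s)) s)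
    {t₀ : ℝ} (ht₀ : t₀ ∈ Ioo a b) (h0 : x t₀ = 0) : ∀ t ∈ Ioo a b, x t = 0 := by
  have hloc : ∀ t ∈ Ioo a b, x t = 0 → ∀ᶠ s in 𝓝 t, x s = 0 := by
    intro t ht h
    obtain ⟨B, hB, hd⟩ := hx t ht
    exact eventually_eq_zero_of_linear hB hd h
  have hcont : ContinuousOn x (Ioo a b) := by
    intro t ht
    obtain ⟨B, hB, hd⟩ := hx t ht
    exact hd.self_of_nhds.continuousAt.continuousWithinAt
  have hsub := isPreconnected_Ioo.subset_left_of_subset_union (s := Ioo a b)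
    (u := {t | ∀ᶠ s in 𝓝 t, x s = 0}) (v := Ioo a b ∩ x ⁻¹' {0}ᶜ)
    isOpen_setOfPred_eventually_nhds
    (hcont.isOpen_inter_preimage isOpen_Ioo isOpen_compl_singleton)
    (disjoint_left.2 fun t h1 h2 ↦ h2.2 (Eventually.self_of_nhds (p := fun s ↦ x s = 0) h1))
    (fun t ht ↦ by
      by_cases h : x t = 0
      · exact Or.inl (hloc t ht h)
      · exact Or.inr ⟨ht, h⟩)
    ⟨t₀, ht₀, hloc t₀ ht₀ h0⟩
  exact fun t ht ↦ Eventually.self_of_nhds (p := fun s ↦ x s = 0) (hsub ht)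

/-- If `ζ` solves the linearization of `z' = V z`, then the derivative of `Dk(ζ)` along `z` is the
differential of the Lie derivative of `k` along `V`, applied to `ζ`. -/
lemma hasDerivAt_fderiv_variation {Y : Type*} [NormedAddCommGroup Y] [NormedSpace ℝ Y]
    {V : X → X} {k : X → Y} {z ζ : ℝ → X} {t : ℝ}
    (hk : ContDiffAt ℝ 2 k (z t)) (hV : DifferentiableAt ℝ V (z t))
    (hz : HasDerivAt z (V (z t)) t) (hζ : HasDerivAt ζ (fderiv ℝ V (z t) (ζ t)) t) :
    HasDerivAt (fun s ↦ fderiv ℝ k (z s) (ζ s))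
      (fderiv ℝ (fun y ↦ fderiv ℝ k y (V y)) (z t) (ζ t)) t := by
  have hd : DifferentiableAt ℝ (fderiv ℝ k) (z t) :=
    (hk.fderiv_right (m := 1) le_rfl).differentiableAt one_ne_zero
  have h1 := (hd.hasFDerivAt.comp_hasDerivAt t hz).clm_apply hζ
  refine h1.congr_deriv ?_
  rw [fderiv_clm_apply hd hV]
  have hs : IsSymmSndFDerivAt ℝ k (z t) := hk.isSymmSndFDerivAt (by simp)
  simp only [add_apply, ContinuousLinearMap.comp_apply,
    ContinuousLinearMap.flip_apply, Function.comp_apply]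
  -- The product rule yields `D²k (V, ζ)`, the differential of the Lie derivative yields `D²k (ζ,
  -- V)`.
  rw [hs.eq (V (z t)) (ζ t)]
  abel

end LinearODE

/-! ### Geodesics tangent to the kernel, in coordinates -/

section GeodesicField

variable {E F : Type*} [NormedAddCommGroup E] [NormedSpace ℝ E]
  [NormedAddCommGroup F] [NormedSpace ℝ F]

/-- The Hessian `D²f - Df ∘ Γ` of `f` with respect to a connection with Christoffel symbol `Γ`. -/
def hessianAt (f : E → F) (Γ : E → E →L[ℝ] E →L[ℝ] E) (x : E) : E →L[ℝ] E →L[ℝ] F :=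
  fderiv ℝ (fderiv ℝ f) x - (ContinuousLinearMap.compL ℝ E E F (fderiv ℝ f x)).comp (Γ x)

lemma hessianAt_apply (f : E → F) (Γ : E → E →L[ℝ] E →L[ℝ] E) (x u v : E) :
    hessianAt f Γ x u v = fderiv ℝ (fderiv ℝ f) x u v - fderiv ℝ f x (Γ x u v) := rfl

/-- The vector field on the tangent bundle whose integral curves are the geodesics. -/
def geodesicField (Γ : E → E →L[ℝ] E →L[ℝ] E) (z : E × E) : E × E :=
  (z.2, -Γ z.1 z.2 z.2)

/-- The differential of `f` as a map on the tangent bundle. -/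
def differentialMap (f : E → F) (z : E × E) : F := fderiv ℝ f z.1 z.2

variable {f : E → F} {Γ : E → E →L[ℝ] E →L[ℝ] E} {z : E × E}

lemma contDiffAt_differentialMap (hf : ContDiffAt ℝ ∞ f z.1) :
    ContDiffAt ℝ ∞ (differentialMap f) z :=
  ((hf.fderiv_right (m := ∞) (by simp)).comp z contDiffAt_fst).clm_apply contDiffAt_snd

lemma contDiffAt_geodesicField (hΓ : ContDiffAt ℝ ∞ Γ z.1) :
    ContDiffAt ℝ ∞ (geodesicField Γ) z :=
  contDiffAt_snd.prodMk
    (((hΓ.comp z contDiffAt_fst).clm_apply contDiffAt_snd).clm_apply contDiffAt_snd).neg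

lemma contDiffAt_hessianAt [FiniteDimensional ℝ E] {x : E} (hf : ContDiffAt ℝ ∞ f x) (hΓ : ContDiffAt ℝ ∞ Γ x) :
    ContDiffAt ℝ ∞ (hessianAt f Γ) x := by
  have h1 : ContDiffAt ℝ ∞ (fderiv ℝ f) x := hf.fderiv_right (m := ∞) (by simp)
  have h2 : ContDiffAt ℝ ∞ (fderiv ℝ (fderiv ℝ f)) x := h1.fderiv_right (m := ∞) (by simp)
  refine contDiffAt_clm_of_apply fun u ↦ contDiffAt_clm_of_apply fun v ↦ ?_
  exact ((h2.clm_apply contDiffAt_const).clm_apply contDiffAt_const).sub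
    (h1.clm_apply ((hΓ.clm_apply contDiffAt_const).clm_apply contDiffAt_const))

lemma fderiv_differentialMap (hf : ContDiffAt ℝ 2 f z.1) (ζ : E × E) :
    fderiv ℝ (differentialMap f) z ζ =
      fderiv ℝ (fderiv ℝ f) z.1 ζ.1 z.2 + fderiv ℝ f z.1 ζ.2 := by
  have hd : DifferentiableAt ℝ (fderiv ℝ f) z.1 :=
    (hf.fderiv_right (m := 1) le_rfl).differentiableAt one_ne_zero
  have := (hd.hasFDerivAt.comp z hasFDerivAt_fst).clm_apply (hasFDerivAt_snd (p := z))
  rw [show differentialMap f = fun z : E × E ↦ (fderiv ℝ f ∘ Prod.fst) z z.2 from rfl,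
    this.fderiv]
  simp [add_comm]

/-- The Christoffel term of the field turns `D²f` into the Hessian; so `Df (c')` has derivative
`Hess f (c', c')` along a geodesic `c`. -/
lemma fderiv_differentialMap_geodesicField (hf : ContDiffAt ℝ 2 f z.1) :
    fderiv ℝ (differentialMap f) z (geodesicField Γ z) = hessianAt f Γ z.1 z.2 z.2 := by
  rw [fderiv_differentialMap hf, hessianAt_apply]
  simp [geodesicField, sub_eq_add_neg]

variable [FiniteDimensional ℝ E] [FiniteDimensional ℝ F]

/-- If the Hessian vanishes on the kernel of `Df` where the rank is maximal, then the quadratic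
form of the Hessian factors smoothly through `Df`. -/
lemma exists_hessianAt_eq {Ω : Set E} (hΩ : IsOpen Ω) (hf : ContDiffOn ℝ ∞ f Ω)
    (hΓ : ContDiffOn ℝ ∞ Γ Ω) {r : ℕ}
    (hr : ∀ x ∈ Ω, Module.finrank ℝ (fderiv ℝ f x).range ≤ r)
    (hH : ∀ x ∈ Ω, Module.finrank ℝ (fderiv ℝ f x).range = r → ∀ u v,
      fderiv ℝ f x u = 0 → fderiv ℝ f x v = 0 → hessianAt f Γ x u v = 0)
    (hz : z.1 ∈ Ω) (hzr : Module.finrank ℝ (fderiv ℝ f z.1).range = r) :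
    ∃ B : E × E → F →L[ℝ] F, ContDiffAt ℝ 1 B z ∧
      ∀ᶠ y in 𝓝 z, hessianAt f Γ y.1 y.2 y.2 = B y (differentialMap f y) := by
  have hfz : ContDiffAt ℝ ∞ f z.1 := hf.contDiffAt (hΩ.mem_nhds hz)
  have hΓz : ContDiffAt ℝ ∞ Γ z.1 := hΓ.contDiffAt (hΩ.mem_nhds hz)
  have hA : ContDiffAt ℝ ∞ (fderiv ℝ f) z.1 := hfz.fderiv_right (m := ∞) (by simp)
  obtain ⟨P, R, hev⟩ := exists_kernel_splitting hA.continuousAt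
  obtain ⟨hP, hR⟩ := hev.self_of_nhds.1 hA
  have hHz := (contDiffAt_hessianAt hfz hΓz).comp z contDiffAt_fst
  have hRz := hR.comp z contDiffAt_fst
  have hPz := hP.comp z contDiffAt_fst
  have hfl : ContDiffAt ℝ ∞ (fun y : E × E ↦ (hessianAt f Γ y.1).flip) z :=
    contDiffAt_clm_of_apply fun u ↦ contDiffAt_clm_of_apply fun v ↦
      (hHz.clm_apply contDiffAt_const).clm_apply contDiffAt_const
  -- Write `v = p + w` with `p = P v` in the kernel and `w = R (Df v)`. Then `H (v, v) = H (v, w) +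
  -- H (w, p) + H (p, p)`, the last term is zero, and the other two are linear in `Df v` once the
  -- remaining entries are regarded as coefficients.
  refine ⟨fun y ↦ (hessianAt f Γ y.1 y.2) ∘L R y.1 +
    ((hessianAt f Γ y.1).flip (P y.1 y.2)) ∘L R y.1, ?_, ?_⟩
  · exact (((hHz.clm_apply contDiffAt_snd).clm_comp hRz).add
      ((hfl.clm_apply (hPz.clm_apply contDiffAt_snd)).clm_comp hRz)).of_le (by norm_cast)
  · have hΩ' : ∀ᶠ y in 𝓝 z, y.1 ∈ Ω := continuousAt_fst (hΩ.mem_nhds hz)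
    filter_upwards [hΩ', (continuousAt_fst (p := z)).eventually hev] with y hy ⟨_, h1, h2, h3⟩
    have hyr : Module.finrank ℝ (fderiv ℝ f y.1).range = r := le_antisymm (hr _ hy) (hzr ▸ h2)
    have hk := h3 (by rw [hyr, hzr]) y.2
    have h0 := hH _ hy hyr _ _ hk hk
    have hu := h1 y.2
    simp only [add_apply, ContinuousLinearMap.comp_apply, ContinuousLinearMap.flip_apply,
      differentialMap]
    set w := R y.1 (fderiv ℝ f y.1 y.2)
    set p := P y.1 y.2
    rw [← hu]
    simp only [map_add, add_apply, h0]
    abel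

/-- Where the rank is maximal, geodesics tangent to the kernel of `Df` stay tangent to it. -/
lemma eventually_differentialMap_eq_zero {Ω : Set E} (hΩ : IsOpen Ω) (hf : ContDiffOn ℝ ∞ f Ω)
    (hΓ : ContDiffOn ℝ ∞ Γ Ω) {r : ℕ}
    (hr : ∀ x ∈ Ω, Module.finrank ℝ (fderiv ℝ f x).range ≤ r)
    (hH : ∀ x ∈ Ω, Module.finrank ℝ (fderiv ℝ f x).range = r → ∀ u v,
      fderiv ℝ f x u = 0 → fderiv ℝ f x v = 0 → hessianAt f Γ x u v = 0)
    {z : ℝ → E × E} {t : ℝ} (hz : ∀ᶠ s in 𝓝 t, HasDerivAt z (geodesicField Γ (z s)) s)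
    (hzΩ : (z t).1 ∈ Ω) (hzr : Module.finrank ℝ (fderiv ℝ f (z t).1).range = r)
    (h0 : differentialMap f (z t) = 0) : ∀ᶠ s in 𝓝 t, differentialMap f (z s) = 0 := by
  obtain ⟨B, hB, hBH⟩ := exists_hessianAt_eq hΩ hf hΓ hr hH hzΩ hzr
  have hzc : ContinuousAt z t := hz.self_of_nhds.continuousAt
  refine eventually_eq_zero_of_linear (B := fun s ↦ B (z s)) (x := fun s ↦ differentialMap f (z s))
    (hB.continuousAt.comp hzc) ?_ h0
  filter_upwards [hz, hzc.eventually hBH,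
    hzc.eventually (continuousAt_fst (hΩ.mem_nhds hzΩ))] with s hs hs2 hs3
  have hfs : ContDiffAt ℝ ∞ f (z s).1 := hf.contDiffAt (hΩ.mem_nhds hs3)
  have := ((contDiffAt_differentialMap hfs).differentiableAt (by simp)).hasFDerivAt.comp_hasDerivAt
    s hs
  rw [fderiv_differentialMap_geodesicField (hfs.of_le (by norm_cast)), hs2] at this
  exact this

/-- The rank of `f` stays maximal at the end of a geodesic that is tangent to the kernel of `Df`:
the Jacobi fields that are tangent to the family of such geodesics have constant image
under `Df`. -/
lemma finrank_range_eq_of_eventually_left {Ω : Set E} (hΩ : IsOpen Ω) (hf : ContDiffOn ℝ ∞ f Ω)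
    (hΓ : ContDiffOn ℝ ∞ Γ Ω) {r : ℕ}
    (hr : ∀ x ∈ Ω, Module.finrank ℝ (fderiv ℝ f x).range ≤ r)
    (hH : ∀ x ∈ Ω, Module.finrank ℝ (fderiv ℝ f x).range = r → ∀ u v,
      fderiv ℝ f x u = 0 → fderiv ℝ f x v = 0 → hessianAt f Γ x u v = 0)
    {z : ℝ → E × E} {b : ℝ} (hz : ∀ᶠ s in 𝓝 b, HasDerivAt z (geodesicField Γ (z s)) s)
    (hzΩ : (z b).1 ∈ Ω)
    (hleft : ∀ᶠ s in 𝓝[<] b, Module.finrank ℝ (fderiv ℝ f (z s).1).range = r ∧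
      differentialMap f (z s) = 0) :
    Module.finrank ℝ (fderiv ℝ f (z b).1).range = r := by
  have hzc : ∀ᶠ s in 𝓝 b, ContinuousAt z s := hz.mono fun s hs ↦ hs.continuousAt
  have hΩs : ∀ᶠ s in 𝓝 b, (z s).1 ∈ Ω :=
    hzc.self_of_nhds.eventually (continuousAt_fst (hΩ.mem_nhds hzΩ))
  have hfΩ : ∀ x ∈ Ω, ContDiffAt ℝ ∞ f x := fun x hx ↦ hf.contDiffAt (hΩ.mem_nhds hx)
  have hΓΩ : ∀ x ∈ Ω, ContDiffAt ℝ ∞ Γ x := fun x hx ↦ hΓ.contDiffAt (hΩ.mem_nhds hx)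
  have h2 : (2 : WithTop ℕ∞) ≤ ∞ := by norm_cast
  have hA : ∀ᶠ s in 𝓝 b, ContinuousAt (fun s ↦ fderiv ℝ (geodesicField Γ) (z s)) s := by
    filter_upwards [hzc, hΩs] with s hs hs'
    exact ((contDiffAt_geodesicField (hΓΩ _ hs')).fderiv_right (m := ∞)
      (by simp)).continuousAt.comp (f := z) hs
  obtain ⟨ε₁, hε₁, hsol⟩ := exists_forall_hasDerivAt_linear hA
  obtain ⟨ε₂, hε₂, hball⟩ := Metric.eventually_nhds_iff_ball.1 (hz.and hΩs)
  obtain ⟨l, hl, hleft'⟩ := mem_nhdsLT_iff_exists_Ioo_subset.1 hleft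
  set p := max (max (b - ε₁) (b - ε₂)) l with hp
  have hpb : p < b := by simp only [hp, max_lt_iff]; exact ⟨⟨by linarith, by linarith⟩, hl⟩
  have hp1 : b - ε₁ ≤ p := (le_max_left _ _).trans (le_max_left _ _)
  have hp2 : b - ε₂ ≤ p := (le_max_right _ _).trans (le_max_left _ _)
  have hp3 : l ≤ p := le_max_right _ _
  have hI : ∀ t ∈ Ioo p b, HasDerivAt z (geodesicField Γ (z t)) t ∧ (z t).1 ∈ Ω ∧
      Module.finrank ℝ (fderiv ℝ f (z t).1).range = r ∧ differentialMap f (z t) = 0 := by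
    intro t ht
    have h1 := hball t (by
      rw [Metric.mem_ball, Real.dist_eq, abs_lt]; constructor <;> linarith [ht.1, ht.2])
    exact ⟨h1.1, h1.2, hleft' ⟨hp3.trans_lt ht.1, ht.2⟩⟩
  obtain ⟨a, ha⟩ : (Ioo p b).Nonempty := nonempty_Ioo.2 hpb
  -- The range of `Df` at time `a` is contained in the range at time `b`; the witness `w` is the
  -- value at `b` of a Jacobi field starting at `w₀`.
  have key : ∀ w₀ : E, ∃ w : E, fderiv ℝ f (z b).1 w = fderiv ℝ f (z a).1 w₀ := by
    intro w₀
    obtain ⟨-, haΩ, har, ha0⟩ := hI a ha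
    -- the initial derivative of the Jacobi field
    obtain ⟨w₁, hw₁⟩ : ∃ w₁, fderiv ℝ (differentialMap f) (z a) (w₀, w₁) = 0 := by
      have hA : ContDiffAt ℝ ∞ (fderiv ℝ f) (z a).1 :=
        (hfΩ _ haΩ).fderiv_right (m := ∞) (by simp)
      obtain ⟨P, R, hev⟩ := exists_kernel_splitting hA.continuousAt
      have hP := (hev.self_of_nhds.1 hA).1
      have hd : DifferentiableAt ℝ (fderiv ℝ f) (z a).1 := hA.differentiableAt (by simp)
      have hPd : DifferentiableAt ℝ (fun x ↦ P x (z a).2) (z a).1 :=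
        (hP.differentiableAt (by simp)).clm_apply (differentiableAt_const _)
      -- The field `x ↦ P x v` extends the kernel vector `v = (z a).2` by kernel vectors.
      -- Differentiating `Df (P v) = 0` in the direction `w₀` shows that `w₁ = D(P v) w₀` makes
      -- `(w₀, w₁)` tangent to the zero set of `differentialMap f`.
      have hzero : (fun x ↦ fderiv ℝ f x (P x (z a).2)) =ᶠ[𝓝 (z a).1] fun _ ↦ 0 := by
        filter_upwards [hev, hΩ.mem_nhds haΩ] with x hx hxΩ
        exact hx.2.2.2 (by rw [har]; exact hr x hxΩ) _
      have hPa : P (z a).1 (z a).2 = (z a).2 := by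
        have := hev.self_of_nhds.2.1 (z a).2
        rw [show fderiv ℝ f (z a).1 (z a).2 = 0 from ha0] at this
        simpa using this
      have hD := hzero.fderiv_eq (𝕜 := ℝ)
      rw [fderiv_clm_apply hd hPd] at hD
      have hD := DFunLike.congr_fun hD w₀
      simp only [add_apply, ContinuousLinearMap.comp_apply, ContinuousLinearMap.flip_apply,
        hPa, fderiv_fun_const, Pi.zero_apply, zero_apply] at hD
      refine ⟨fderiv ℝ (fun x ↦ P x (z a).2) (z a).1 w₀, ?_⟩
      rw [fderiv_differentialMap ((hfΩ _ haΩ).of_le h2), ← hD, add_comm]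
    -- The solution is defined on both sides of `b`: the linearized geodesic equation involves only
    -- `Γ` and `z`, not the rank of `Df`.
    obtain ⟨ζ, hζa, hζ⟩ := hsol a ⟨by linarith [ha.1], by linarith [ha.2]⟩ (w₀, w₁)
    have hζI : ∀ t ∈ Ioo p b, HasDerivAt ζ (fderiv ℝ (geodesicField Γ) (z t) (ζ t)) t :=
      fun t ht ↦ hζ t ⟨by linarith [ht.1], by linarith [ht.2]⟩
    -- The Lie derivative of `Df` along the geodesic field is `B (Df)`. Its differential along `ζ`
    -- is `B` applied to the unknown, since the term with the derivative of `B` is multiplied by `Df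
    -- (z) = 0`. So the unknown solves a linear equation with zero initial value.
    have hψ : ∀ t ∈ Ioo p b, fderiv ℝ (differentialMap f) (z t) (ζ t) = 0 := by
      refine eq_zero_of_linear (x := fun t ↦ fderiv ℝ (differentialMap f) (z t) (ζ t))
        (fun t ht ↦ ?_) ha (by simp only [hζa, hw₁])
      obtain ⟨B, hB, hBH⟩ := exists_hessianAt_eq hΩ hf hΓ hr hH (hI t ht).2.1 (hI t ht).2.2.1
      have hzt := (hI t ht).1.continuousAt
      refine ⟨fun s ↦ B (z s), hB.continuousAt.comp hzt, ?_⟩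
      filter_upwards [isOpen_Ioo.mem_nhds ht, hzt.eventually hBH.eventually_nhds,
        hzt.eventually (hB.eventually (by simp))] with s hs hsH hsB
      obtain ⟨h1, h3, h4, h5⟩ := hI s hs
      refine (hasDerivAt_fderiv_variation ((contDiffAt_differentialMap (hfΩ _ h3)).of_le h2)
        ((contDiffAt_geodesicField (hΓΩ _ h3)).differentiableAt (by simp)) h1
        (hζI s hs)).congr_deriv ?_
      have heq : (fun y ↦ fderiv ℝ (differentialMap f) y (geodesicField Γ y)) =ᶠ[𝓝 (z s)]
          fun y ↦ B y (differentialMap f y) := by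
        filter_upwards [hsH, continuousAt_fst (hΩ.mem_nhds h3)] with y hy hyΩ
        rw [fderiv_differentialMap_geodesicField ((hfΩ _ hyΩ).of_le h2), hy]
      rw [heq.fderiv_eq, fderiv_clm_apply (hsB.differentiableAt (by simp))
        ((contDiffAt_differentialMap (hfΩ _ h3)).differentiableAt (by simp))]
      simp [h5]
    -- Apply the variation formula to `f ∘ Prod.fst`: its Lie derivative is `differentialMap f`,
    -- whose differential kills `ζ` by `hψ`.
    have hconst : ∀ t ∈ Ioo p b, fderiv ℝ f (z t).1 (ζ t).1 = fderiv ℝ f (z a).1 w₀ := by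
      have hfst : ∀ (x : E × E), x.1 ∈ Ω → ∀ y,
          fderiv ℝ (fun z : E × E ↦ f z.1) x y = fderiv ℝ f x.1 y.1 := by
        intro x hx y
        have h := (((hfΩ _ hx).differentiableAt (by simp)).hasFDerivAt.comp x
          (hasFDerivAt_fst (𝕜 := ℝ) (E := E) (F := E))).fderiv
        rw [show (fun z : E × E ↦ f z.1) = f ∘ Prod.fst from rfl, h]
        rfl
      have hder : ∀ t ∈ Ioo p b, HasDerivAt (fun s ↦ fderiv ℝ (fun z : E × E ↦ f z.1) (z s) (ζ s))
          0 t := by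
        intro t ht
        obtain ⟨h1, h3, h4, h5⟩ := hI t ht
        refine (hasDerivAt_fderiv_variation
          (((hfΩ _ h3).comp (z t) contDiffAt_fst).of_le h2)
          ((contDiffAt_geodesicField (hΓΩ _ h3)).differentiableAt (by simp)) h1
          (hζI t ht)).congr_deriv ?_
        have heq : (fun y ↦ fderiv ℝ (f ∘ Prod.fst) y (geodesicField Γ y)) =ᶠ[𝓝 (z t)]
            differentialMap f := by
          filter_upwards [continuousAt_fst (hΩ.mem_nhds h3)] with y hy
          exact hfst y hy _
        rw [heq.fderiv_eq, hψ t ht]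
      intro t ht
      have := isOpen_Ioo.is_const_of_deriv_eq_zero isPreconnected_Ioo
        (fun t ht ↦ (hder t ht).differentiableAt.differentiableWithinAt)
        (fun t ht ↦ (hder t ht).deriv) ht ha
      rwa [hfst _ (hI t ht).2.1, hfst _ (hI a ha).2.1, hζa] at this
    refine ⟨(ζ b).1, ?_⟩
    have hcont : ContinuousAt (fun t ↦ fderiv ℝ f (z t).1 (ζ t).1) b := by
      have h1 : ContinuousAt (fun t ↦ fderiv ℝ f (z t).1) b :=
        ((hfΩ _ hzΩ).fderiv_right (m := ∞) (by simp)).continuousAt.comp (f := fun t ↦ (z t).1)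
          (continuousAt_fst.comp hzc.self_of_nhds)
      exact h1.clm_apply (continuousAt_fst.comp
        (hζ b ⟨by linarith, by linarith⟩).continuousAt)
    refine tendsto_nhds_unique (hcont.tendsto.mono_left (nhdsWithin_le_nhds (s := Iio b))) ?_
    refine (tendsto_const_nhds).congr' ?_
    filter_upwards [Ioo_mem_nhdsLT hpb] with t ht
    exact (hconst t ht).symm
  refine le_antisymm (hr _ hzΩ) ?_
  rw [← (hI a ha).2.2.1]
  apply Submodule.finrank_mono
  rintro _ ⟨w₀, rfl⟩
  exact key w₀

end GeodesicField

lemma two_le_infty : (2 : WithTop ℕ∞) ≤ ∞ := by norm_cast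

/-- The composition of a smooth map with the inverse of a chart is smooth. -/
lemma contMDiffAt_comp_extChartAt_symm {E : Type*} [NormedAddCommGroup E] [NormedSpace ℝ E]
    {M : Type*} [TopologicalSpace M] [ChartedSpace E M]
    {K : Type*} [NormedAddCommGroup K] [NormedSpace ℝ K]
    {L : Type*} [TopologicalSpace L] [ChartedSpace K L] [IsManifold 𝓘(ℝ, K) ∞ L]
    {q₀ : L} {j : L → M} {y : K} (hy : y ∈ (extChartAt 𝓘(ℝ, K) q₀).target)
    (hj : ContMDiffAt 𝓘(ℝ, K) 𝓘(ℝ, E) ∞ j ((extChartAt 𝓘(ℝ, K) q₀).symm y)) :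
    ContMDiffAt 𝓘(ℝ, K) 𝓘(ℝ, E) ∞ (j ∘ (extChartAt 𝓘(ℝ, K) q₀).symm) y :=
  hj.comp y ((contMDiffOn_extChartAt_symm q₀).contMDiffAt
    ((isOpen_extChartAt_target q₀).mem_nhds hy))

/-! ### Maps and forms in charts -/

section Charts

variable {E : Type*} [NormedAddCommGroup E] [NormedSpace ℝ E]
  {M : Type*} [TopologicalSpace M] [ChartedSpace E M]
  {K : Type*} [NormedAddCommGroup K] [NormedSpace ℝ K]
  {L : Type*} [TopologicalSpace L] [ChartedSpace K L]

lemma pullbackForm_mfderiv_congr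
    (g : ∀ x : M, TangentSpace 𝓘(ℝ, E) x →L[ℝ] TangentSpace 𝓘(ℝ, E) x →L[ℝ] ℝ)
    {h h' : K → M} {y : K} (hh : h =ᶠ[𝓝 y] h') :
    pullbackForm (g (h y)) (mfderiv 𝓘(ℝ, K) 𝓘(ℝ, E) h y) =
      pullbackForm (g (h' y)) (mfderiv 𝓘(ℝ, K) 𝓘(ℝ, E) h' y) := by
  have e1 := hh.mfderiv_eq (I := 𝓘(ℝ, K)) (I' := 𝓘(ℝ, E))
  have e2 := hh.eq_of_nhds
  -- All tangent spaces are the model space by definition, so `g` can be read as a family of forms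
  -- on one fixed space.
  let G : M → E →L[ℝ] E →L[ℝ] ℝ := g
  change pullbackForm (V := K) (W := E) (G (h y)) (mfderiv 𝓘(ℝ, K) 𝓘(ℝ, E) h y) =
    pullbackForm (V := K) (W := E) (G (h' y)) (mfderiv 𝓘(ℝ, K) 𝓘(ℝ, E) h' y)
  rw [e2]
  exact congrArg (pullbackForm (V := K) (W := E) (G (h' y))) e1

/-- The expression of a map `j : L → M` in the charts around `q₀` and `x₀`. -/
def inCharts (q₀ : L) (x₀ : M) (j : L → M) (y : K) : E :=
  extChartAt 𝓘(ℝ, E) x₀ (j ((extChartAt 𝓘(ℝ, K) q₀).symm y))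

variable [IsManifold 𝓘(ℝ, E) ∞ M]

lemma contMDiffAt_extChartAt_symm {x₀ : M} {y : E} (hy : y ∈ (extChartAt 𝓘(ℝ, E) x₀).target) :
    ContMDiffAt 𝓘(ℝ, E) 𝓘(ℝ, E) ∞ (extChartAt 𝓘(ℝ, E) x₀).symm y :=
  (contMDiffOn_extChartAt_symm x₀).contMDiffAt ((isOpen_extChartAt_target x₀).mem_nhds hy)

lemma contMDiffAt_extChartAt_of_mem {x₀ x : M} (hx : x ∈ (extChartAt 𝓘(ℝ, E) x₀).source) :
    ContMDiffAt 𝓘(ℝ, E) 𝓘(ℝ, E) ∞ (extChartAt 𝓘(ℝ, E) x₀) x :=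
  contMDiffAt_extChartAt' (by rwa [extChartAt_source] at hx)

lemma mfderiv_extChartAt_comp_symm {x₀ : M} {y : E} (hy : y ∈ (extChartAt 𝓘(ℝ, E) x₀).target) :
    (mfderiv 𝓘(ℝ, E) 𝓘(ℝ, E) (extChartAt 𝓘(ℝ, E) x₀) ((extChartAt 𝓘(ℝ, E) x₀).symm y)) ∘L
      (mfderiv 𝓘(ℝ, E) 𝓘(ℝ, E) (extChartAt 𝓘(ℝ, E) x₀).symm y) =
      ContinuousLinearMap.id ℝ _ := by
  have : IsManifold 𝓘(ℝ, E) 1 M := .of_le (n := ∞) (by norm_cast)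
  have := mfderiv_extChartAt_comp_mfderivWithin_extChartAt_symm (I := 𝓘(ℝ, E)) hy
  rwa [ModelWithCorners.range_eq_univ, mfderivWithin_univ] at this

lemma mfderiv_extChartAt_symm_comp {x₀ : M} {y : E} (hy : y ∈ (extChartAt 𝓘(ℝ, E) x₀).target) :
    (mfderiv 𝓘(ℝ, E) 𝓘(ℝ, E) (extChartAt 𝓘(ℝ, E) x₀).symm y) ∘L
    (mfderiv 𝓘(ℝ, E) 𝓘(ℝ, E) (extChartAt 𝓘(ℝ, E) x₀) ((extChartAt 𝓘(ℝ, E) x₀).symm y)) =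
      ContinuousLinearMap.id ℝ _ := by
  have : IsManifold 𝓘(ℝ, E) 1 M := .of_le (n := ∞) (by norm_cast)
  have := mfderivWithin_extChartAt_symm_comp_mfderiv_extChartAt (I := 𝓘(ℝ, E)) hy
  rwa [ModelWithCorners.range_eq_univ, mfderivWithin_univ] at this

lemma mfderiv_extChartAt_injective {x₀ x : M} (hx : x ∈ (extChartAt 𝓘(ℝ, E) x₀).source) :
    Function.Injective (mfderiv 𝓘(ℝ, E) 𝓘(ℝ, E) (extChartAt 𝓘(ℝ, E) x₀) x) := by
  have : IsManifold 𝓘(ℝ, E) 1 M := .of_le (n := ∞) (by norm_cast)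
  exact (isInvertible_mfderiv_extChartAt hx).injective

variable [IsManifold 𝓘(ℝ, K) ∞ L] {q₀ : L} {x₀ : M} {j : L → M} {y : K}

lemma contDiffAt_inCharts (hy : y ∈ (extChartAt 𝓘(ℝ, K) q₀).target)
    (hj : ContMDiffAt 𝓘(ℝ, K) 𝓘(ℝ, E) ∞ j ((extChartAt 𝓘(ℝ, K) q₀).symm y))
    (hjy : j ((extChartAt 𝓘(ℝ, K) q₀).symm y) ∈ (extChartAt 𝓘(ℝ, E) x₀).source) :
    ContDiffAt ℝ ∞ (inCharts (E := E) q₀ x₀ j) y :=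
  contMDiffAt_iff_contDiffAt.1 ((contMDiffAt_extChartAt_of_mem hjy).comp y
    (contMDiffAt_comp_extChartAt_symm hy hj))

lemma fderiv_inCharts (hy : y ∈ (extChartAt 𝓘(ℝ, K) q₀).target)
    (hj : ContMDiffAt 𝓘(ℝ, K) 𝓘(ℝ, E) ∞ j ((extChartAt 𝓘(ℝ, K) q₀).symm y))
    (hjy : j ((extChartAt 𝓘(ℝ, K) q₀).symm y) ∈ (extChartAt 𝓘(ℝ, E) x₀).source) (v : K) :
    fderiv ℝ (inCharts (E := E) q₀ x₀ j) y v =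
      mfderiv 𝓘(ℝ, E) 𝓘(ℝ, E) (extChartAt 𝓘(ℝ, E) x₀) (j ((extChartAt 𝓘(ℝ, K) q₀).symm y))
        (mfderiv 𝓘(ℝ, K) 𝓘(ℝ, E) j ((extChartAt 𝓘(ℝ, K) q₀).symm y)
          (mfderiv 𝓘(ℝ, K) 𝓘(ℝ, K) (extChartAt 𝓘(ℝ, K) q₀).symm y v)) := by
  rw [← mfderiv_eq_fderiv]
  have h1 : mfderiv 𝓘(ℝ, K) 𝓘(ℝ, E) (inCharts (E := E) q₀ x₀ j) y = _ :=
    mfderiv_comp y ((contMDiffAt_extChartAt_of_mem hjy).mdifferentiableAt (by simp))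
      ((contMDiffAt_comp_extChartAt_symm hy hj).mdifferentiableAt (by simp))
  have h2 : mfderiv 𝓘(ℝ, K) 𝓘(ℝ, E) (j ∘ (extChartAt 𝓘(ℝ, K) q₀).symm) y = _ :=
    mfderiv_comp y (hj.mdifferentiableAt (by simp))
      ((contMDiffAt_extChartAt_symm hy).mdifferentiableAt (by simp))
  rw [h1]
  exact congrArg (mfderiv 𝓘(ℝ, E) 𝓘(ℝ, E) (extChartAt 𝓘(ℝ, E) x₀)
    (j ((extChartAt 𝓘(ℝ, K) q₀).symm y))) (DFunLike.congr_fun h2 v)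

end Charts

lemma inducedMetric_id {E : Type*} [NormedAddCommGroup E] [NormedSpace ℝ E]
    {M : Type u} [TopologicalSpace M] [ChartedSpace E M]
    (g : ∀ x : M, TangentSpace 𝓘(ℝ, E) x →L[ℝ] TangentSpace 𝓘(ℝ, E) x →L[ℝ] ℝ) :
    inducedMetric E g (id : M → M) = g := by
  ext x v w
  simp only [inducedMetric, mfderiv_id]
  rfl

/-! ### The induced metric in charts -/

section InducedMetric

variable {E : Type*} [NormedAddCommGroup E] [NormedSpace ℝ E]
  {M : Type u} [TopologicalSpace M] [ChartedSpace E M] [IsManifold 𝓘(ℝ, E) ∞ M]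
  {K : Type*} [NormedAddCommGroup K] [NormedSpace ℝ K]
  {L : Type u} [TopologicalSpace L] [ChartedSpace K L] [IsManifold 𝓘(ℝ, K) ∞ L]
  {q₀ : L} {x₀ : M} {j : L → M} {y : K}

/-- The coordinate expression of the induced metric is the pullback of the coordinate expression
of the metric. -/
lemma formInChart_inducedMetric
    (g : ∀ x : M, TangentSpace 𝓘(ℝ, E) x →L[ℝ] TangentSpace 𝓘(ℝ, E) x →L[ℝ] ℝ)
    (hy : y ∈ (extChartAt 𝓘(ℝ, K) q₀).target)
    (hj : ContMDiffAt 𝓘(ℝ, K) 𝓘(ℝ, E) ∞ j ((extChartAt 𝓘(ℝ, K) q₀).symm y))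
    (hjy : j ((extChartAt 𝓘(ℝ, K) q₀).symm y) ∈ (extChartAt 𝓘(ℝ, E) x₀).source) :
    formInChart (inducedMetric K g j) q₀ y =
      pullbackForm (formInChart g x₀ (inCharts q₀ x₀ j y))
        (fderiv ℝ (inCharts (E := E) q₀ x₀ j) y) := by
  have hi := contDiffAt_inCharts hy hj hjy
  have hit : inCharts (E := E) q₀ x₀ j y ∈ (extChartAt 𝓘(ℝ, E) x₀).target :=
    (extChartAt 𝓘(ℝ, E) x₀).map_source hjy
  have h2 : mfderiv 𝓘(ℝ, K) 𝓘(ℝ, E) (j ∘ (extChartAt 𝓘(ℝ, K) q₀).symm) y = _ :=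
    mfderiv_comp y (hj.mdifferentiableAt (by simp))
      ((contMDiffAt_extChartAt_symm hy).mdifferentiableAt (by simp))
  have h3 : mfderiv 𝓘(ℝ, K) 𝓘(ℝ, E)
      ((extChartAt 𝓘(ℝ, E) x₀).symm ∘ inCharts (E := E) q₀ x₀ j) y = _ :=
    mfderiv_comp y ((contMDiffAt_extChartAt_symm hit).mdifferentiableAt (by simp))
      ((contMDiffAt_iff_contDiffAt.2 hi).mdifferentiableAt (by simp))
  have hcongr : j ∘ (extChartAt 𝓘(ℝ, K) q₀).symm =ᶠ[𝓝 y]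
      (extChartAt 𝓘(ℝ, E) x₀).symm ∘ inCharts (E := E) q₀ x₀ j := by
    filter_upwards [(contMDiffAt_comp_extChartAt_symm hy hj).continuousAt
      ((isOpen_extChartAt_source x₀).mem_nhds hjy)] with z hz
    exact ((extChartAt 𝓘(ℝ, E) x₀).left_inv hz).symm
  have key := pullbackForm_mfderiv_congr g hcongr
  rw [h2, h3, mfderiv_eq_fderiv] at key
  exact key

end InducedMetric

/-! ### Positive forms and derivatives of pullback forms -/

section Christoffel

variable {E : Type*} [NormedAddCommGroup E] [NormedSpace ℝ E]
  {K : Type*} [NormedAddCommGroup K] [NormedSpace ℝ K]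

/-- A positive definite form maps `E` injectively to its dual, which has the same dimension. -/
lemma isInvertible_of_pos [FiniteDimensional ℝ E] {B : E →L[ℝ] E →L[ℝ] ℝ}
    (hB : ∀ v, v ≠ 0 → 0 < B v v) : B.IsInvertible := by
  have hinj : Function.Injective (B : E →ₗ[ℝ] E →L[ℝ] ℝ) := by
    rw [injective_iff_map_eq_zero]
    intro v hv
    by_contra hne
    have := hB v hne
    rw [show B v = 0 from hv] at this
    simp at this
  have hd : Module.finrank ℝ E = Module.finrank ℝ (E →L[ℝ] ℝ) := by
    rw [← (LinearMap.toContinuousLinearMap : (E →ₗ[ℝ] ℝ) ≃ₗ[ℝ] E →L[ℝ] ℝ).finrank_eq]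
    exact (Subspace.dual_finrank_eq (K := ℝ) (V := E)).symm
  exact ⟨(LinearEquiv.ofBijective (B : E →ₗ[ℝ] E →L[ℝ] ℝ)
    ⟨hinj, (LinearMap.injective_iff_surjective_of_finrank_eq_finrank hd).1 hinj⟩).toContinuousLinearEquiv, rfl⟩

lemma pullbackForm_apply (B : E →L[ℝ] E →L[ℝ] ℝ) (A : K →L[ℝ] E) (v w : K) :
    pullbackForm B A v w = B (A v) (A w) := rfl

/-- The product rule for `G (i) (Di v, Di w)`: one term for the metric and one for each slot. This
is the input of the Gauss formula. -/
lemma fderiv_pullbackForm {G : E → E →L[ℝ] E →L[ℝ] ℝ} {i : K → E} {y : K}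
    (hG : DifferentiableAt ℝ G (i y)) (hi : ContDiffAt ℝ 2 i y)
    {G' : K → K →L[ℝ] K →L[ℝ] ℝ}
    (hG' : G' =ᶠ[𝓝 y] fun z ↦ pullbackForm (G (i z)) (fderiv ℝ i z))
    (hGd : DifferentiableAt ℝ G' y) (u v w : K) :
    fderiv ℝ G' y u v w = fderiv ℝ G (i y) (fderiv ℝ i y u) (fderiv ℝ i y v) (fderiv ℝ i y w)
      + G (i y) (fderiv ℝ (fderiv ℝ i) y u v) (fderiv ℝ i y w)
      + G (i y) (fderiv ℝ i y v) (fderiv ℝ (fderiv ℝ i) y u w) := by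
  have hid : HasFDerivAt i (fderiv ℝ i y) y := (hi.differentiableAt (by simp)).hasFDerivAt
  have hd : HasFDerivAt (fderiv ℝ i) (fderiv ℝ (fderiv ℝ i) y) y :=
    ((hi.fderiv_right (m := 1) le_rfl).differentiableAt one_ne_zero).hasFDerivAt
  have h0 := HasFDerivAt.comp (G := E →L[ℝ] E →L[ℝ] ℝ) (g := G) y hG.hasFDerivAt hid
  have hv := HasFDerivAt.clm_apply (H := E) hd (hasFDerivAt_const v y)
  have hw := HasFDerivAt.clm_apply (H := E) hd (hasFDerivAt_const w y)
  have h1 := (HasFDerivAt.clm_apply (H := E →L[ℝ] ℝ) h0 hv).clm_apply hw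
  have h2 := (HasFDerivAt.clm_apply (H := K →L[ℝ] ℝ) (c := G') hGd.hasFDerivAt
    (hasFDerivAt_const v y)).clm_apply (hasFDerivAt_const w y)
  have h3 : (fun z ↦ G' z v w) =ᶠ[𝓝 y]
      fun z ↦ (G ∘ i) z (fderiv ℝ i z v) (fderiv ℝ i z w) := by
    filter_upwards [hG'] with z hz
    rw [hz]; rfl
  have h4 := DFunLike.congr_fun ((h1.congr_of_eventuallyEq h3).unique h2) u
  simp only [add_apply, ContinuousLinearMap.comp_apply, ContinuousLinearMap.flip_apply,
    zero_add, Function.comp_apply, ContinuousLinearMap.comp_zero] at h4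
  rw [← h4]
  ring

end Christoffel

/-! ### Smoothness and positivity of the metric in charts -/

section Metric

variable {E : Type*} [NormedAddCommGroup E] [NormedSpace ℝ E]
  {M : Type u} [TopologicalSpace M] [ChartedSpace E M] [IsManifold 𝓘(ℝ, E) ∞ M]

/-- A vector field whose coordinate expression in a chart is smooth is smooth. -/
lemma contMDiffAt_mfderiv_extChartAt_symm {x₀ : M} {y : E}
    (hy : y ∈ (extChartAt 𝓘(ℝ, E) x₀).target) {X : E → E} (hX : ContDiffAt ℝ ∞ X y) :
    ContMDiffAt 𝓘(ℝ, E) 𝓘(ℝ, E).tangent ∞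
      (fun z ↦ (⟨(extChartAt 𝓘(ℝ, E) x₀).symm z,
        mfderiv 𝓘(ℝ, E) 𝓘(ℝ, E) (extChartAt 𝓘(ℝ, E) x₀).symm z (X z)⟩ :
        TangentBundle 𝓘(ℝ, E) M)) y := by
  have ho := isOpen_extChartAt_target (I := 𝓘(ℝ, E)) x₀
  have h1 := (contMDiffOn_extChartAt_symm (I := 𝓘(ℝ, E)) (n := ∞) x₀).contMDiffOn_tangentMapWithin
    (m := ∞) (by simp) ho.uniqueMDiffOn
  have h2 : ContMDiffAt 𝓘(ℝ, E) 𝓘(ℝ, E).tangent ∞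
      (fun z ↦ (⟨z, X z⟩ : TangentBundle 𝓘(ℝ, E) E)) y := by
    rw [Bundle.contMDiffAt_totalSpace]
    refine ⟨contMDiffAt_id, ?_⟩
    simpa using! contMDiffAt_iff_contDiffAt.2 hX
  have h3 : ContMDiffAt 𝓘(ℝ, E).tangent 𝓘(ℝ, E).tangent ∞
      (tangentMapWithin 𝓘(ℝ, E) 𝓘(ℝ, E) (extChartAt 𝓘(ℝ, E) x₀).symm
        (extChartAt 𝓘(ℝ, E) x₀).target) (⟨y, X y⟩ : TangentBundle 𝓘(ℝ, E) E) :=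
    h1.contMDiffAt ((ho.preimage (FiberBundle.continuous_proj E _)).mem_nhds hy)
  refine (h3.comp y h2).congr_of_eventuallyEq ?_
  filter_upwards [ho.mem_nhds hy] with z hz
  simp only [Function.comp_apply, tangentMapWithin, mfderivWithin_of_isOpen ho hz]

variable (g : Bundle.ContMDiffRiemannianMetric 𝓘(ℝ, E) ∞ E
      (fun x : M ↦ TangentSpace 𝓘(ℝ, E) x)) {x₀ : M} {y : E}

lemma contDiffAt_formInChart [FiniteDimensional ℝ E] (hy : y ∈ (extChartAt 𝓘(ℝ, E) x₀).target) :
    ContDiffAt ℝ ∞ (formInChart g.inner x₀) y := by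
  refine contDiffAt_clm_of_apply fun v ↦ contDiffAt_clm_of_apply fun w ↦ ?_
  rw [← contMDiffAt_iff_contDiffAt]
  have : ContMDiffAt 𝓘(ℝ, E) (𝓘(ℝ, E).prod 𝓘(ℝ, ℝ)) ∞
      (fun z ↦ Bundle.TotalSpace.mk' ℝ (E := Bundle.Trivial M ℝ)
        ((extChartAt 𝓘(ℝ, E) x₀).symm z)
        (g.inner ((extChartAt 𝓘(ℝ, E) x₀).symm z)
          (mfderiv 𝓘(ℝ, E) 𝓘(ℝ, E) (extChartAt 𝓘(ℝ, E) x₀).symm z v)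
          (mfderiv 𝓘(ℝ, E) 𝓘(ℝ, E) (extChartAt 𝓘(ℝ, E) x₀).symm z w))) y := by
    apply ContMDiffAt.clm_bundle_apply₂ (F₁ := E) (F₂ := E)
    · exact g.contMDiff.contMDiffAt.comp y (contMDiffAt_extChartAt_symm hy)
    · exact contMDiffAt_mfderiv_extChartAt_symm hy (X := fun _ ↦ v) contDiffAt_const
    · exact contMDiffAt_mfderiv_extChartAt_symm hy (X := fun _ ↦ w) contDiffAt_const
  simp only [Bundle.contMDiffAt_totalSpace] at this
  exact this.2

lemma formInChart_symm (v w : E) :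
    formInChart g.inner x₀ y v w = formInChart g.inner x₀ y w v :=
  g.symm _ _ _

lemma formInChart_pos (hy : y ∈ (extChartAt 𝓘(ℝ, E) x₀).target) {v : E} (hv : v ≠ 0) :
    0 < formInChart g.inner x₀ y v v := by
  refine g.pos _ _ fun h ↦ hv ?_
  have h1 := congrArg
    (mfderiv 𝓘(ℝ, E) 𝓘(ℝ, E) (extChartAt 𝓘(ℝ, E) x₀) ((extChartAt 𝓘(ℝ, E) x₀).symm y)) h
  exact (DFunLike.congr_fun (mfderiv_extChartAt_comp_symm hy) v).symm.trans
    (h1.trans (map_zero _))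

end Metric

/-! ### Christoffel symbols -/

section Christoffel

variable {E : Type*} [NormedAddCommGroup E] [NormedSpace ℝ E]
  {M : Type*} [TopologicalSpace M] [ChartedSpace E M]

lemma christoffelFirst_apply
    (g : ∀ x : M, TangentSpace 𝓘(ℝ, E) x →L[ℝ] TangentSpace 𝓘(ℝ, E) x →L[ℝ] ℝ)
    (x₀ : M) (y v v' w : E) :
    christoffelFirst g x₀ y v v' w = (1 / 2 : ℝ) * (fderiv ℝ (formInChart g x₀) y v v' w +
      fderiv ℝ (formInChart g x₀) y v' v w - fderiv ℝ (formInChart g x₀) y w v v') := rfl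

/-- Invertibility matters: `ContinuousLinearMap.inverse` is zero on maps that are not invertible. -/
lemma formInChart_christoffel
    {g : ∀ x : M, TangentSpace 𝓘(ℝ, E) x →L[ℝ] TangentSpace 𝓘(ℝ, E) x →L[ℝ] ℝ}
    {x₀ : M} {y : E} (h : (formInChart g x₀ y).IsInvertible) (v v' : E) :
    formInChart g x₀ y (christoffel g x₀ y v v') = christoffelFirst g x₀ y v v' := by
  obtain ⟨e, he⟩ := h
  rw [christoffel, ← he]
  simp

/-- The Christoffel symbol as a bilinear map. -/
def christoffelBilin [FiniteDimensional ℝ E]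
    (g : ∀ x : M, TangentSpace 𝓘(ℝ, E) x →L[ℝ] TangentSpace 𝓘(ℝ, E) x →L[ℝ] ℝ)
    (x₀ : M) (y : E) : E →L[ℝ] E →L[ℝ] E :=
  LinearMap.toContinuousLinearMap (LinearMap.toContinuousLinearMap.toLinearMap ∘ₗ
    LinearMap.mk₂ ℝ (fun v v' ↦ christoffel g x₀ y v v')
      (fun v₁ v₂ v' ↦ by
        simp only [christoffel, ← map_add]
        congr 1
        ext w
        simp only [christoffelFirst_apply, add_apply, map_add]
        ring)
      (fun c v v' ↦ by
        simp only [christoffel, ← map_smul]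
        congr 1
        ext w
        simp only [christoffelFirst_apply, smul_apply, map_smul, smul_eq_mul]
        ring)
      (fun v v₁ v₂ ↦ by
        simp only [christoffel, ← map_add]
        congr 1
        ext w
        simp only [christoffelFirst_apply, add_apply, map_add]
        ring)
      (fun c v v' ↦ by
        simp only [christoffel, ← map_smul]
        congr 1
        ext w
        simp only [christoffelFirst_apply, smul_apply, map_smul, smul_eq_mul]
        ring))

lemma christoffelBilin_apply [FiniteDimensional ℝ E]
    (g : ∀ x : M, TangentSpace 𝓘(ℝ, E) x →L[ℝ] TangentSpace 𝓘(ℝ, E) x →L[ℝ] ℝ)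
    (x₀ : M) (y v v' : E) : christoffelBilin g x₀ y v v' = christoffel g x₀ y v v' := rfl

lemma contDiffAt_christoffelBilin [FiniteDimensional ℝ E]
    {g : ∀ x : M, TangentSpace 𝓘(ℝ, E) x →L[ℝ] TangentSpace 𝓘(ℝ, E) x →L[ℝ] ℝ}
    {x₀ : M} {y : E} (h : (formInChart g x₀ y).IsInvertible)
    (hg : ContDiffAt ℝ ∞ (formInChart g x₀) y) :
    ContDiffAt ℝ ∞ (christoffelBilin g x₀) y := by
  refine contDiffAt_clm_of_apply fun v ↦ contDiffAt_clm_of_apply fun v' ↦ ?_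
  have hD : ContDiffAt ℝ ∞ (fderiv ℝ (formInChart g x₀)) y := hg.fderiv_right (m := ∞) (by simp)
  have hD' : ∀ a b c : E, ContDiffAt ℝ ∞ (fun z ↦ fderiv ℝ (formInChart g x₀) z a b c) y :=
    fun a b c ↦ ((hD.clm_apply contDiffAt_const).clm_apply contDiffAt_const).clm_apply
      contDiffAt_const
  have h1 : ContDiffAt ℝ ∞ (fun z ↦ christoffelFirst g x₀ z v v') y := by
    refine contDiffAt_clm_of_apply fun w ↦ ?_
    simp only [christoffelFirst_apply]
    exact contDiffAt_const.mul (((hD' v v' w).add (hD' v' v w)).sub (hD' w v v'))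
  have h2 : ContDiffAt ℝ ∞ (fun z ↦ (formInChart g x₀ z).inverse) y := by
    obtain ⟨e, he⟩ := h
    have h3 : ContDiffAt ℝ ∞ (ContinuousLinearMap.inverse : (E →L[ℝ] E →L[ℝ] ℝ) → _)
        (formInChart g x₀ y) := by
      rw [← he]
      exact contDiffAt_map_inverse e
    exact h3.comp y hg
  exact h2.clm_apply h1

end Christoffel

/-! ### The Gauss formula and the transformation law -/

section Gauss

variable {E : Type*} [NormedAddCommGroup E] [NormedSpace ℝ E] [FiniteDimensional ℝ E]
  {M : Type u} [TopologicalSpace M] [ChartedSpace E M] [IsManifold 𝓘(ℝ, E) ∞ M]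
  {K : Type*} [NormedAddCommGroup K] [NormedSpace ℝ K] [FiniteDimensional ℝ K]
  {L : Type u} [TopologicalSpace L] [ChartedSpace K L] [IsManifold 𝓘(ℝ, K) ∞ L]
  (g : Bundle.ContMDiffRiemannianMetric 𝓘(ℝ, E) ∞ E (fun x : M ↦ TangentSpace 𝓘(ℝ, E) x))
  {q₀ : L} {x₀ : M} {j : L → M} {y : K}

/-- The Gauss formula in coordinates. -/
lemma christoffelFirst_inducedMetric
    (hy : y ∈ (extChartAt 𝓘(ℝ, K) q₀).target) (hj : ContMDiff 𝓘(ℝ, K) 𝓘(ℝ, E) ∞ j)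
    (hjy : j ((extChartAt 𝓘(ℝ, K) q₀).symm y) ∈ (extChartAt 𝓘(ℝ, E) x₀).source) (v v' w : K) :
    christoffelFirst (inducedMetric K g.inner j) q₀ y v v' w =
      formInChart g.inner x₀ (inCharts q₀ x₀ j y)
        (fderiv ℝ (fderiv ℝ (inCharts (E := E) q₀ x₀ j)) y v v' +
          christoffel g.inner x₀ (inCharts q₀ x₀ j y)
            (fderiv ℝ (inCharts (E := E) q₀ x₀ j) y v)
            (fderiv ℝ (inCharts (E := E) q₀ x₀ j) y v'))
        (fderiv ℝ (inCharts (E := E) q₀ x₀ j) y w) := by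
  have hit : inCharts (E := E) q₀ x₀ j y ∈ (extChartAt 𝓘(ℝ, E) x₀).target :=
    (extChartAt 𝓘(ℝ, E) x₀).map_source hjy
  have hi := contDiffAt_inCharts hy hj.contMDiffAt hjy
  have hG := contDiffAt_formInChart g hit
  have hinv : (formInChart g.inner x₀ (inCharts q₀ x₀ j y)).IsInvertible :=
    isInvertible_of_pos fun v hv ↦ formInChart_pos g hit hv
  have hev : formInChart (inducedMetric K g.inner j) q₀ =ᶠ[𝓝 y]
      fun z ↦ pullbackForm (formInChart g.inner x₀ (inCharts q₀ x₀ j z))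
        (fderiv ℝ (inCharts (E := E) q₀ x₀ j) z) := by
    filter_upwards [(isOpen_extChartAt_target q₀).mem_nhds hy,
      (contMDiffAt_comp_extChartAt_symm hy hj.contMDiffAt).continuousAt
        ((isOpen_extChartAt_source x₀).mem_nhds hjy)] with z hz hz'
    exact formInChart_inducedMetric g.inner hz hj.contMDiffAt hz'
  have hGd : DifferentiableAt ℝ (formInChart (inducedMetric K g.inner j) q₀) y := by
    refine DifferentiableAt.congr_of_eventuallyEq ?_ hev
    refine ContDiffAt.differentiableAt (n := ∞) ?_ (by simp)
    refine contDiffAt_clm_of_apply fun a ↦ contDiffAt_clm_of_apply fun b ↦ ?_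
    have hD : ContDiffAt ℝ ∞ (fderiv ℝ (inCharts (E := E) q₀ x₀ j)) y :=
      hi.fderiv_right (m := ∞) (by simp)
    exact ((hG.comp y hi).clm_apply (hD.clm_apply contDiffAt_const)).clm_apply
      (hD.clm_apply contDiffAt_const)
  have hF := fderiv_pullbackForm (hG.differentiableAt (by simp)) (hi.of_le two_le_infty) hev hGd
  have hs : IsSymmSndFDerivAt ℝ (inCharts (E := E) q₀ x₀ j) y :=
    (hi.of_le two_le_infty).isSymmSndFDerivAt (by simp)
  -- Of the six terms with second derivatives of `j`, four cancel by the symmetry of `D²` and of the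
  -- metric, and the two others agree. The derivatives of the metric combine to the Christoffel
  -- symbol of `M`.
  rw [christoffelFirst_apply, hF, hF, hF, map_add, add_apply, formInChart_christoffel hinv,
    christoffelFirst_apply, hs.eq v' v, hs.eq w v, hs.eq w v',
    formInChart_symm g (fderiv ℝ (inCharts (E := E) q₀ x₀ j) y v') _]
  ring

/-- The transformation law of the Christoffel symbol under a change of charts. -/
lemma fderiv_inCharts_christoffel {p x : M} {y : E}
    (hy : y ∈ (extChartAt 𝓘(ℝ, E) x).target)
    (hyp : (extChartAt 𝓘(ℝ, E) x).symm y ∈ (extChartAt 𝓘(ℝ, E) p).source) (v v' : E) :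
    fderiv ℝ (inCharts (E := E) x p (id : M → M)) y (christoffel g.inner x y v v') =
      fderiv ℝ (fderiv ℝ (inCharts (E := E) x p (id : M → M))) y v v' +
        christoffel g.inner p (inCharts x p (id : M → M) y)
          (fderiv ℝ (inCharts (E := E) x p (id : M → M)) y v)
          (fderiv ℝ (inCharts (E := E) x p (id : M → M)) y v') := by
  have hit : inCharts (E := E) x p (id : M → M) y ∈ (extChartAt 𝓘(ℝ, E) p).target :=
    (extChartAt 𝓘(ℝ, E) p).map_source hyp
  have hinv : (formInChart g.inner x y).IsInvertible :=
    isInvertible_of_pos fun v hv ↦ formInChart_pos g hy hv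
  have hD := fderiv_inCharts hy (contMDiff_id (I := 𝓘(ℝ, E)) (M := M)).contMDiffAt hyp
  have hinj : Function.Injective (fderiv ℝ (inCharts (E := E) x p (id : M → M)) y) := by
    intro a b hab
    rw [hD, hD] at hab
    have h1 := mfderiv_extChartAt_injective hyp hab
    simp only [mfderiv_id] at h1
    have h2 := congrArg
      (mfderiv 𝓘(ℝ, E) 𝓘(ℝ, E) (extChartAt 𝓘(ℝ, E) x) ((extChartAt 𝓘(ℝ, E) x).symm y)) h1
    have h3 := mfderiv_extChartAt_comp_symm hy
    exact ((DFunLike.congr_fun h3 a).symm.trans h2).trans (DFunLike.congr_fun h3 b)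
  have hsurj : Function.Surjective (fderiv ℝ (inCharts (E := E) x p (id : M → M)) y) :=
    (LinearMap.injective_iff_surjective
      (f := (fderiv ℝ (inCharts (E := E) x p (id : M → M)) y : E →ₗ[ℝ] E))).1 hinj
  -- The transformation law is the Gauss formula for the identity of `M`; the coordinate change has
  -- surjective differential, so every `w` is available as a test vector.
  have key : ∀ w, formInChart g.inner p (inCharts x p (id : M → M) y)
      (fderiv ℝ (inCharts (E := E) x p (id : M → M)) y (christoffel g.inner x y v v')) w =
      formInChart g.inner p (inCharts x p (id : M → M) y)
        (fderiv ℝ (fderiv ℝ (inCharts (E := E) x p (id : M → M))) y v v' +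
        christoffel g.inner p (inCharts x p (id : M → M) y)
          (fderiv ℝ (inCharts (E := E) x p (id : M → M)) y v)
          (fderiv ℝ (inCharts (E := E) x p (id : M → M)) y v')) w := by
    intro w
    obtain ⟨w, rfl⟩ := hsurj w
    rw [← christoffelFirst_inducedMetric g hy contMDiff_id hyp, ← pullbackForm_apply,
      ← formInChart_inducedMetric g.inner hy contMDiff_id.contMDiffAt hyp, inducedMetric_id,
      formInChart_christoffel hinv]
  obtain ⟨e, he⟩ : (formInChart g.inner p (inCharts x p (id : M → M) y)).IsInvertible :=
    isInvertible_of_pos fun v hv ↦ formInChart_pos g hit hv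
  rw [← he] at key
  exact e.injective (ContinuousLinearMap.ext key)

end Gauss

lemma finrank_range_of_comp {V V' W W' : Type*} [AddCommGroup V] [Module ℝ V] [AddCommGroup V']
    [Module ℝ V'] [AddCommGroup W] [Module ℝ W] [AddCommGroup W'] [Module ℝ W']
    {A : W →ₗ[ℝ] W'} {B : V →ₗ[ℝ] W} {C : V' →ₗ[ℝ] V} {D : V' →ₗ[ℝ] W'}
    (hA : Function.Injective A) (hC : Function.Surjective C) (hD : ∀ v, D v = A (B (C v))) :
    Module.finrank ℝ (LinearMap.range D) = Module.finrank ℝ (LinearMap.range B) := by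
  have : LinearMap.range D = (LinearMap.range B).map A := by
    ext w
    simp only [LinearMap.mem_range, Submodule.mem_map, exists_exists_eq_and, hD]
    exact ⟨fun ⟨v, hv⟩ ↦ ⟨C v, hv⟩, fun ⟨v, hv⟩ ↦ let ⟨v', h⟩ := hC v; ⟨v', by rw [h, hv]⟩⟩
  rw [this]
  exact (Submodule.equivMapOfInjective A hA _).finrank_eq.symm

/-- The Hessian is invariant under changes of coordinates. -/
lemma hessianAt_comp {E F : Type*} [NormedAddCommGroup E] [NormedSpace ℝ E]
    [NormedAddCommGroup F] [NormedSpace ℝ F] {E' : Type*} [NormedAddCommGroup E']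
    [NormedSpace ℝ E'] {f : E → F} {i : E' → E} {y : E'} {h : E' → F}
    {Γ : E → E →L[ℝ] E →L[ℝ] E} {Γ' : E' → E' →L[ℝ] E' →L[ℝ] E'}
    (hf : ContDiffAt ℝ 2 f (i y)) (hi : ContDiffAt ℝ 2 i y) (hh : h =ᶠ[𝓝 y] f ∘ i) {u v : E'}
    (hΓ : fderiv ℝ i y (Γ' y u v) =
      fderiv ℝ (fderiv ℝ i) y u v + Γ (i y) (fderiv ℝ i y u) (fderiv ℝ i y v)) :
    hessianAt h Γ' y u v = hessianAt f Γ (i y) (fderiv ℝ i y u) (fderiv ℝ i y v) := by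
  have hev : fderiv ℝ h =ᶠ[𝓝 y] fun z ↦ (fderiv ℝ f (i z)).comp (fderiv ℝ i z) := by
    filter_upwards [hh.eventuallyEq_nhds, hi.eventually (by simp),
      hi.continuousAt.eventually (hf.eventually (by simp))] with z hz hiz hfz
    rw [hz.fderiv_eq, fderiv_comp z (hfz.differentiableAt (by simp))
      (hiz.differentiableAt (by simp))]
  have hdf : DifferentiableAt ℝ (fderiv ℝ f) (i y) :=
    (hf.fderiv_right (m := 1) le_rfl).differentiableAt one_ne_zero
  have hdi : DifferentiableAt ℝ (fderiv ℝ i) y :=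
    (hi.fderiv_right (m := 1) le_rfl).differentiableAt one_ne_zero
  have h2 := (hdf.hasFDerivAt.comp y (hi.differentiableAt (by simp)).hasFDerivAt).clm_comp
    hdi.hasFDerivAt
  have h3 : fderiv ℝ (fderiv ℝ h) y u v =
      fderiv ℝ (fderiv ℝ f) (i y) (fderiv ℝ i y u) (fderiv ℝ i y v) +
        fderiv ℝ f (i y) (fderiv ℝ (fderiv ℝ i) y u v) := by
    rw [hev.fderiv_eq]
    refine (DFunLike.congr_fun (DFunLike.congr_fun h2.fderiv u) v).trans ?_
    simp [add_comm]
  rw [hessianAt_apply, hessianAt_apply, h3, hev.self_of_nhds, ContinuousLinearMap.comp_apply, hΓ,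
    map_add]
  abel

/-! ### Rank and kernel in charts -/

section Kernel

variable {E : Type*} [NormedAddCommGroup E] [NormedSpace ℝ E]
  {M : Type*} [TopologicalSpace M] [ChartedSpace E M] [IsManifold 𝓘(ℝ, E) ∞ M]
  {F : Type*} [NormedAddCommGroup F] [NormedSpace ℝ F]
  {N : Type*} [TopologicalSpace N] [ChartedSpace F N] [IsManifold 𝓘(ℝ, F) ∞ N]
  {f : M → N} {x₀ : M} {y₀ : N} {y : E}

lemma fderiv_inCharts_eq_zero_iff (hf : ContMDiff 𝓘(ℝ, E) 𝓘(ℝ, F) ∞ f)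
    (hy : y ∈ (extChartAt 𝓘(ℝ, E) x₀).target)
    (hfy : f ((extChartAt 𝓘(ℝ, E) x₀).symm y) ∈ (extChartAt 𝓘(ℝ, F) y₀).source) (v : E) :
    fderiv ℝ (inCharts (E := F) x₀ y₀ f) y v = 0 ↔
      mfderiv 𝓘(ℝ, E) 𝓘(ℝ, F) f ((extChartAt 𝓘(ℝ, E) x₀).symm y)
        (mfderiv 𝓘(ℝ, E) 𝓘(ℝ, E) (extChartAt 𝓘(ℝ, E) x₀).symm y v) = 0 := by
  rw [fderiv_inCharts hy hf.contMDiffAt hfy]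
  exact map_eq_zero_iff _ (mfderiv_extChartAt_injective hfy)

lemma mfderiv_extChartAt_symm_surjective (hy : y ∈ (extChartAt 𝓘(ℝ, E) x₀).target) :
    Function.Surjective (mfderiv 𝓘(ℝ, E) 𝓘(ℝ, E) (extChartAt 𝓘(ℝ, E) x₀).symm y) := fun v ↦
  ⟨_, DFunLike.congr_fun (mfderiv_extChartAt_symm_comp hy) v⟩

lemma finrank_range_fderiv_inCharts (hf : ContMDiff 𝓘(ℝ, E) 𝓘(ℝ, F) ∞ f)
    (hy : y ∈ (extChartAt 𝓘(ℝ, E) x₀).target)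
    (hfy : f ((extChartAt 𝓘(ℝ, E) x₀).symm y) ∈ (extChartAt 𝓘(ℝ, F) y₀).source) :
    Module.finrank ℝ (fderiv ℝ (inCharts (E := F) x₀ y₀ f) y).range =
      rankAt E F f ((extChartAt 𝓘(ℝ, E) x₀).symm y) :=
  finrank_range_of_comp
    (A := (mfderiv 𝓘(ℝ, F) 𝓘(ℝ, F) (extChartAt 𝓘(ℝ, F) y₀)
      (f ((extChartAt 𝓘(ℝ, E) x₀).symm y))).toLinearMap)
    (B := (mfderiv 𝓘(ℝ, E) 𝓘(ℝ, F) f ((extChartAt 𝓘(ℝ, E) x₀).symm y)).toLinearMap)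
    (C := (mfderiv 𝓘(ℝ, E) 𝓘(ℝ, E) (extChartAt 𝓘(ℝ, E) x₀).symm y).toLinearMap)
    (mfderiv_extChartAt_injective hfy) (mfderiv_extChartAt_symm_surjective hy)
    (fun v ↦ fderiv_inCharts hy hf.contMDiffAt hfy v)

/-- The rank is lower semicontinuous: near `x` it is at least the rank at `x`, which is already
maximal. -/
lemma isOpen_maxRankSet [FiniteDimensional ℝ E] [FiniteDimensional ℝ F]
    (hf : ContMDiff 𝓘(ℝ, E) 𝓘(ℝ, F) ∞ f) : IsOpen (maxRankSet E F f) := by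
  rw [isOpen_iff_mem_nhds]
  intro x hx
  have hxs := mem_extChartAt_source (I := 𝓘(ℝ, E)) x
  have hxt := (extChartAt 𝓘(ℝ, E) x).map_source hxs
  have hl := (extChartAt 𝓘(ℝ, E) x).left_inv hxs
  have hfx : f ((extChartAt 𝓘(ℝ, E) x).symm (extChartAt 𝓘(ℝ, E) x x)) ∈
      (extChartAt 𝓘(ℝ, F) (f x)).source := by rw [hl]; exact mem_extChartAt_source _
  obtain ⟨P, R, hev⟩ := exists_kernel_splitting
    ((contDiffAt_inCharts hxt hf.contMDiffAt hfx).fderiv_right (m := ∞) (by simp)).continuousAt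
  filter_upwards [(continuousAt_extChartAt x).eventually hev,
    (isOpen_extChartAt_source (I := 𝓘(ℝ, E)) x).mem_nhds hxs,
    hf.continuous.continuousAt ((isOpen_extChartAt_source (f x)).mem_nhds
      (mem_extChartAt_source (I := 𝓘(ℝ, F)) (f x)))] with z hz hzs hzf
  have hl' := (extChartAt 𝓘(ℝ, E) x).left_inv hzs
  have h := hz.2.2.1
  rw [finrank_range_fderiv_inCharts hf hxt hfx, finrank_range_fderiv_inCharts hf
    ((extChartAt 𝓘(ℝ, E) x).map_source hzs) (by rw [hl']; exact hzf), hl, hl'] at h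
  exact fun w ↦ (hx w).trans h

end Kernel

/-! ### Autoparallel kernels and the Hessian -/

section Autoparallel

variable {E : Type*} [NormedAddCommGroup E] [NormedSpace ℝ E] [FiniteDimensional ℝ E]
  {M : Type u} [TopologicalSpace M] [ChartedSpace E M] [IsManifold 𝓘(ℝ, E) ∞ M]
  {F : Type*} [NormedAddCommGroup F] [NormedSpace ℝ F] [FiniteDimensional ℝ F]
  {N : Type*} [TopologicalSpace N] [ChartedSpace F N] [IsManifold 𝓘(ℝ, F) ∞ N]
  {f : M → N} {x₀ : M} {y₀ : N}

/-- The Hessian of `f` vanishes on an autoparallel kernel distribution (at the center of a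
chart). -/
lemma hessianAt_center_eq_zero
    (g : ∀ x : M, TangentSpace 𝓘(ℝ, E) x →L[ℝ] TangentSpace 𝓘(ℝ, E) x →L[ℝ] ℝ)
    (hf : ContMDiff 𝓘(ℝ, E) 𝓘(ℝ, F) ∞ f)
    (hauto : IsAutoparallelOn g (kerDistribution E F f) (maxRankSet E F f))
    {p : M} (hp : p ∈ maxRankSet E F f) (hfp : f p ∈ (extChartAt 𝓘(ℝ, F) y₀).source) {u v : E}
    (hu : fderiv ℝ (inCharts (E := F) p y₀ f) (extChartAt 𝓘(ℝ, E) p p) u = 0)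
    (hv : fderiv ℝ (inCharts (E := F) p y₀ f) (extChartAt 𝓘(ℝ, E) p p) v = 0) :
    hessianAt (inCharts (E := F) p y₀ f) (christoffelBilin g p) (extChartAt 𝓘(ℝ, E) p p) u v
      = 0 := by
  set φ := extChartAt 𝓘(ℝ, E) p with hφ
  have hps : p ∈ φ.source := mem_extChartAt_source p
  have hpt : φ p ∈ φ.target := φ.map_source hps
  have hl : φ.symm (φ p) = p := φ.left_inv hps
  set h := inCharts (K := E) (E := F) p y₀ f with hh
  have hsm : ∀ z ∈ φ.target, f (φ.symm z) ∈ (extChartAt 𝓘(ℝ, F) y₀).source →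
      ContDiffAt ℝ ∞ h z := fun z hz hz' ↦ contDiffAt_inCharts hz hf.contMDiffAt hz'
  have hfp' : f (φ.symm (φ p)) ∈ (extChartAt 𝓘(ℝ, F) y₀).source := by rwa [hl]
  have hA : ContDiffAt ℝ ∞ (fderiv ℝ h) (φ p) := (hsm _ hpt hfp').fderiv_right (m := ∞) (by simp)
  obtain ⟨P, R, hev⟩ := exists_kernel_splitting hA.continuousAt
  -- a neighbourhood on which everything is defined
  obtain ⟨V, hVsub, hVo, hpV⟩ : ∃ V ⊆ {x | x ∈ φ.source ∧
      f x ∈ (extChartAt 𝓘(ℝ, F) y₀).source ∧ x ∈ maxRankSet E F f ∧ ContDiffAt ℝ ∞ P (φ x) ∧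
      ∀ w, fderiv ℝ h (φ x) (P (φ x) w) = 0}, IsOpen V ∧ p ∈ V := by
    apply mem_nhds_iff.1
    filter_upwards [(continuousAt_extChartAt p).eventually hev,
      (isOpen_extChartAt_source (I := 𝓘(ℝ, E)) p).mem_nhds hps,
      hf.continuous.continuousAt ((isOpen_extChartAt_source y₀).mem_nhds hfp),
      (isOpen_maxRankSet hf).mem_nhds hp] with x hx hxs hxf hxU
    have hlx : φ.symm (φ x) = x := φ.left_inv hxs
    have hxt : φ x ∈ φ.target := φ.map_source hxs
    have hxf' : f (φ.symm (φ x)) ∈ (extChartAt 𝓘(ℝ, F) y₀).source := by rw [hlx]; exact hxf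
    refine ⟨hxs, hxf, hxU, (hx.1 ((hsm _ hxt hxf').fderiv_right (m := ∞) (by simp))).1,
      hx.2.2.2 ?_⟩
    rw [finrank_range_fderiv_inCharts hf hxt hxf', finrank_range_fderiv_inCharts hf hpt hfp', hlx,
      hl]
    exact hp x
  -- The projections `P z` applied to a constant `w` give, as `S w`, a local section of the kernel;
  -- for `w` in the kernel at `p` its coordinate value at `p` is `w` itself.
  let Q : E → E → E := fun w z ↦ mfderiv 𝓘(ℝ, E) 𝓘(ℝ, E) φ.symm z (P z w)
  let S : E → ∀ x : M, TangentSpace 𝓘(ℝ, E) x := fun w x ↦ Q w (φ x)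
  have hfield : ∀ w, fieldInChart (S w) p =ᶠ[𝓝 (φ p)] fun z ↦ P z w := by
    intro w
    filter_upwards [(isOpen_extChartAt_target p).mem_nhds hpt] with z hz
    have h1 : Q w (φ (φ.symm z)) = Q w z := congrArg (Q w) (φ.right_inv hz)
    refine (congrArg (mfderiv 𝓘(ℝ, E) 𝓘(ℝ, E) φ (φ.symm z)) h1).trans ?_
    exact DFunLike.congr_fun (mfderiv_extChartAt_comp_symm hz) (P z w)
  have hcongr : ∀ (x x' : M) (_ : x = x') (w : E),
      (⟨x, w⟩ : TangentBundle 𝓘(ℝ, E) M) = ⟨x', w⟩ := by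
    rintro x _ rfl w; rfl
  have hSsm : ∀ w, ContMDiffOn 𝓘(ℝ, E) 𝓘(ℝ, E).tangent ∞
      (fun x ↦ (⟨x, S w x⟩ : TangentBundle 𝓘(ℝ, E) M)) V := by
    intro w x hx
    obtain ⟨hxs, -, -, hPx, -⟩ := hVsub hx
    have h1 := (contMDiffAt_mfderiv_extChartAt_symm (φ.map_source hxs)
      (hPx.clm_apply (contDiffAt_const (c := w)))).comp x (contMDiffAt_extChartAt_of_mem hxs)
    refine (h1.congr_of_eventuallyEq ?_).contMDiffWithinAt
    filter_upwards [(isOpen_extChartAt_source p).mem_nhds hxs] with x' hx'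
    exact hcongr _ _ (φ.left_inv hx').symm _
  have hSker : ∀ w, ∀ x ∈ V, S w x ∈ kerDistribution E F f x := by
    intro w x hx
    obtain ⟨hxs, hxf, -, -, hk⟩ := hVsub hx
    have hlx : φ.symm (φ x) = x := φ.left_inv hxs
    have h1 := (fderiv_inCharts_eq_zero_iff hf (φ.map_source hxs)
      (by rw [hlx]; exact hxf) _).1 (hk w)
    let D : M → E →L[ℝ] F := fun x ↦ mfderiv 𝓘(ℝ, E) 𝓘(ℝ, F) f x
    change D x (Q w (φ x)) = 0
    change D (φ.symm (φ x)) (Q w (φ x)) = 0 at h1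
    rwa [hlx] at h1
  have hPfix : ∀ w, fderiv ℝ h (φ p) w = 0 → P (φ p) w = w := by
    intro w hw
    have := hev.self_of_nhds.2.1 w
    rw [hw] at this
    simpa using this
  have hLC := hauto V hVo (fun x hx ↦ (hVsub hx).2.2.1) (S u) (S v) (hSsm u) (hSsm v)
    (hSker u) (hSker v) p hpV
  have hLC' : fderiv ℝ h (φ p) (fderiv ℝ (fieldInChart (S v) p) (φ p) (fieldInChart (S u) p (φ p))
      + christoffel g p (φ p) (fieldInChart (S u) p (φ p)) (fieldInChart (S v) p (φ p))) = 0 := by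
    rw [fderiv_inCharts_eq_zero_iff hf hpt hfp']
    let D : M → E →L[ℝ] F := fun x ↦ mfderiv 𝓘(ℝ, E) 𝓘(ℝ, F) f x
    change D p (leviCivita g (S u) (S v) p) = 0 at hLC
    change D (φ.symm (φ p)) (leviCivita g (S u) (S v) p) = 0
    rwa [hl]
  rw [(hfield v).fderiv_eq, (hfield u).self_of_nhds.trans (hPfix u hu),
    (hfield v).self_of_nhds.trans (hPfix v hv), map_add] at hLC'
  -- differentiate `Dh (P v) = 0`
  have hPd : DifferentiableAt ℝ (fun z ↦ P z v) (φ p) :=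
    ((hVsub hpV).2.2.2.1.differentiableAt (by simp)).clm_apply (differentiableAt_const _)
  have hzero : (fun z ↦ fderiv ℝ h z (P z v)) =ᶠ[𝓝 (φ p)] fun _ ↦ 0 := by
    have hV' : ∀ᶠ z in 𝓝 (φ p), φ.symm z ∈ V :=
      (contMDiffAt_extChartAt_symm hpt).continuousAt.eventually
        (by rw [hl]; exact hVo.mem_nhds hpV)
    filter_upwards [hV', (isOpen_extChartAt_target p).mem_nhds hpt] with z hz hzt
    have := (hVsub hz).2.2.2.2 v
    rwa [φ.right_inv hzt] at this
  have hD := hzero.fderiv_eq (𝕜 := ℝ)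
  rw [fderiv_clm_apply (hA.differentiableAt (by simp)) hPd] at hD
  have hD := DFunLike.congr_fun hD u
  simp only [add_apply, ContinuousLinearMap.comp_apply, ContinuousLinearMap.flip_apply,
    hPfix v hv, fderiv_fun_const, Pi.zero_apply, zero_apply] at hD
  -- Autoparallelism gives `Dh (D(P v) u + Γ (u, v)) = 0`, and differentiating `Dh (P v) = 0` gives
  -- `D²h (u, v) + Dh (D(P v) u) = 0`. The difference is the Hessian.
  rw [hessianAt_apply, christoffelBilin_apply, sub_eq_zero]
  rw [add_comm] at hD
  exact (add_eq_zero_iff_eq_neg.1 hD).trans (add_eq_zero_iff_eq_neg'.1 hLC').symm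

/-- The Hessian of `f` vanishes on an autoparallel kernel distribution. -/
lemma hessianAt_eq_zero_of_isAutoparallelOn
    (g : Bundle.ContMDiffRiemannianMetric 𝓘(ℝ, E) ∞ E (fun x : M ↦ TangentSpace 𝓘(ℝ, E) x))
    (hf : ContMDiff 𝓘(ℝ, E) 𝓘(ℝ, F) ∞ f)
    (hauto : IsAutoparallelOn g.inner (kerDistribution E F f) (maxRankSet E F f)) {y : E}
    (hy : y ∈ (extChartAt 𝓘(ℝ, E) x₀).target)
    (hfy : f ((extChartAt 𝓘(ℝ, E) x₀).symm y) ∈ (extChartAt 𝓘(ℝ, F) y₀).source)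
    (hyU : (extChartAt 𝓘(ℝ, E) x₀).symm y ∈ maxRankSet E F f) {u v : E}
    (hu : fderiv ℝ (inCharts (E := F) x₀ y₀ f) y u = 0)
    (hv : fderiv ℝ (inCharts (E := F) x₀ y₀ f) y v = 0) :
    hessianAt (inCharts (E := F) x₀ y₀ f) (christoffelBilin g.inner x₀) y u v = 0 := by
  -- `leviCivita` is computed at each point in the chart centered there, so the previous lemma only
  -- speaks of centers. Pass to the chart at `p` and use the invariance of the Hessian.
  set p := (extChartAt 𝓘(ℝ, E) x₀).symm y with hp
  have hps : p ∈ (extChartAt 𝓘(ℝ, E) p).source := mem_extChartAt_source p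
  set i := inCharts (K := E) (E := E) x₀ p (id : M → M) with hi
  have hiy : i y = extChartAt 𝓘(ℝ, E) p p := rfl
  have hism : ContDiffAt ℝ ∞ i y := contDiffAt_inCharts hy contMDiff_id.contMDiffAt hps
  have hpt : extChartAt 𝓘(ℝ, E) p p ∈ (extChartAt 𝓘(ℝ, E) p).target :=
    (extChartAt 𝓘(ℝ, E) p).map_source hps
  have hl : (extChartAt 𝓘(ℝ, E) p).symm (extChartAt 𝓘(ℝ, E) p p) = p :=
    (extChartAt 𝓘(ℝ, E) p).left_inv hps
  have hfsm : ContDiffAt ℝ ∞ (inCharts (E := F) p y₀ f) (i y) := by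
    rw [hiy]
    exact contDiffAt_inCharts hpt hf.contMDiffAt (by rw [hl]; exact hfy)
  have hcomp : inCharts (E := F) x₀ y₀ f =ᶠ[𝓝 y] inCharts (E := F) p y₀ f ∘ i := by
    filter_upwards [(contMDiffAt_extChartAt_symm hy).continuousAt
      ((isOpen_extChartAt_source p).mem_nhds hps)] with z hz
    exact (congrArg (fun x ↦ extChartAt 𝓘(ℝ, F) y₀ (f x))
      ((extChartAt 𝓘(ℝ, E) p).left_inv hz)).symm
  have hD : fderiv ℝ (inCharts (E := F) x₀ y₀ f) y =
      (fderiv ℝ (inCharts (E := F) p y₀ f) (i y)).comp (fderiv ℝ i y) := by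
    rw [hcomp.fderiv_eq, fderiv_comp y (hfsm.differentiableAt (by simp))
      (hism.differentiableAt (by simp))]
  rw [hD] at hu hv
  rw [hessianAt_comp (Γ := christoffelBilin g.inner p) (hfsm.of_le two_le_infty)
    (hism.of_le two_le_infty) hcomp (fderiv_inCharts_christoffel g hy hps u v)]
  exact hessianAt_center_eq_zero g.inner hf hauto hyU hfy hu hv

end Autoparallel

/-- A smooth map with vanishing differential on a connected manifold is constant. -/
lemma eq_of_mfderiv_eq_zero {K : Type*} [NormedAddCommGroup K] [NormedSpace ℝ K]
    {L : Type*} [TopologicalSpace L] [ChartedSpace K L] [IsManifold 𝓘(ℝ, K) ∞ L]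
    {F : Type*} [NormedAddCommGroup F] [NormedSpace ℝ F]
    {N : Type*} [TopologicalSpace N] [ChartedSpace F N] [IsManifold 𝓘(ℝ, F) ∞ N]
    [PreconnectedSpace L] {f : L → N} (hf : ContMDiff 𝓘(ℝ, K) 𝓘(ℝ, F) ∞ f)
    (h0 : ∀ q, mfderiv 𝓘(ℝ, K) 𝓘(ℝ, F) f q = 0) (p q : L) : f p = f q := by
  have hloc : IsLocallyConstant f := by
    rw [IsLocallyConstant.iff_eventually_eq]
    intro q
    set φ := extChartAt 𝓘(ℝ, K) q
    set ψ := extChartAt 𝓘(ℝ, F) (f q)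
    have hq : q ∈ φ.source := mem_extChartAt_source q
    have hqt : φ q ∈ φ.target := φ.map_source hq
    have hl : φ.symm (φ q) = q := φ.left_inv hq
    have hev : ∀ᶠ y in 𝓝 (φ q), y ∈ φ.target ∧ f (φ.symm y) ∈ ψ.source := by
      have h1 : ContinuousAt (f ∘ φ.symm) (φ q) :=
        (contMDiffAt_comp_extChartAt_symm hqt hf.contMDiffAt).continuousAt
      refine ((isOpen_extChartAt_target q).eventually_mem hqt).and
        (h1.eventually ((isOpen_extChartAt_source (f q)).mem_nhds ?_))
      rw [Function.comp_apply, hl]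
      exact mem_extChartAt_source (f q)
    obtain ⟨ε, hε, hball⟩ := Metric.eventually_nhds_iff_ball.1 hev
    have hd : ∀ y ∈ Metric.ball (φ q) ε,
        fderiv ℝ (inCharts (K := K) (E := F) q (f q) f) y = 0 := by
      intro y hy
      ext v
      rw [fderiv_inCharts (hball y hy).1 hf.contMDiffAt (hball y hy).2, h0]
      exact map_zero _
    have hconst : ∀ y ∈ Metric.ball (φ q) ε,
        inCharts (K := K) (E := F) q (f q) f y = inCharts (K := K) (E := F) q (f q) f (φ q) :=
      fun y hy ↦ Metric.isOpen_ball.is_const_of_fderiv_eq_zero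
        (convex_ball (φ q) ε).isPreconnected
        (fun y hy ↦ ((contDiffAt_inCharts (hball y hy).1 hf.contMDiffAt
          (hball y hy).2).differentiableAt (by simp)).differentiableWithinAt)
        hd hy (Metric.mem_ball_self hε)
    filter_upwards [(continuousAt_extChartAt (I := 𝓘(ℝ, K)) q) (Metric.ball_mem_nhds _ hε),
      (isOpen_extChartAt_source (I := 𝓘(ℝ, K)) q).mem_nhds hq] with x hx hxs
    have h1 := hconst _ hx
    simp only [inCharts] at h1
    have h2 := ψ.injOn (hball _ hx).2 (by rw [hl]; exact mem_extChartAt_source (f q)) h1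
    rwa [hl, φ.left_inv hxs] at h2
  exact hloc.apply_eq_of_preconnectedSpace p q

/-! ### Velocities of curves in charts -/

section Curves

variable {F : Type*} [NormedAddCommGroup F] [NormedSpace ℝ F]
  {N : Type*} [TopologicalSpace N] [ChartedSpace F N] {c : ℝ → N} {t : ℝ} {y₀ : N}

lemma mfderiv_curve_eq_zero_iff :
    mfderiv 𝓘(ℝ, ℝ) 𝓘(ℝ, F) c t = 0 ↔ mfderiv 𝓘(ℝ, ℝ) 𝓘(ℝ, F) c t (1 : ℝ) = 0 := by
  refine ⟨fun h ↦ by rw [h]; rfl, fun h ↦ ?_⟩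
  refine ContinuousLinearMap.ext fun s : ℝ ↦ ?_
  let A : ℝ →L[ℝ] F := mfderiv 𝓘(ℝ, ℝ) 𝓘(ℝ, F) c t
  change A s = 0
  rw [show s = s • (1 : ℝ) by simp, map_smul, show A 1 = 0 from h, smul_zero]

lemma mfderiv_comp_neg_eq_zero {c c' : ℝ → N} (hc : ContMDiff 𝓘(ℝ, ℝ) 𝓘(ℝ, F) ∞ c)
    (hc' : c' = fun s ↦ c (-s)) {s t : ℝ} (hst : s = -t)
    (h : mfderiv 𝓘(ℝ, ℝ) 𝓘(ℝ, F) c s = 0) : mfderiv 𝓘(ℝ, ℝ) 𝓘(ℝ, F) c' t = 0 := by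
  subst hst hc'
  have h1 : mfderiv 𝓘(ℝ, ℝ) 𝓘(ℝ, F) (fun s ↦ c (-s)) t = _ :=
    mfderiv_comp (f := fun s : ℝ ↦ -s) t (hc.contMDiffAt.mdifferentiableAt (by simp))
      ((contMDiff_iff_contDiff.2 contDiff_neg).mdifferentiable (n := ∞) (by simp) t)
  rw [h1, h]
  exact ContinuousLinearMap.zero_comp _

variable [IsManifold 𝓘(ℝ, F) ∞ N]

lemma contDiffAt_extChartAt_comp (hc : ContMDiff 𝓘(ℝ, ℝ) 𝓘(ℝ, F) ∞ c)
    (ht : c t ∈ (extChartAt 𝓘(ℝ, F) y₀).source) :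
    ContDiffAt ℝ ∞ (fun s ↦ extChartAt 𝓘(ℝ, F) y₀ (c s)) t :=
  contMDiffAt_iff_contDiffAt.1 ((contMDiffAt_extChartAt_of_mem ht).comp t hc.contMDiffAt)

lemma deriv_extChartAt_comp (hc : ContMDiff 𝓘(ℝ, ℝ) 𝓘(ℝ, F) ∞ c)
    (ht : c t ∈ (extChartAt 𝓘(ℝ, F) y₀).source) :
    deriv (fun s ↦ extChartAt 𝓘(ℝ, F) y₀ (c s)) t =
      mfderiv 𝓘(ℝ, F) 𝓘(ℝ, F) (extChartAt 𝓘(ℝ, F) y₀) (c t)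
        (mfderiv 𝓘(ℝ, ℝ) 𝓘(ℝ, F) c t (1 : ℝ)) := by
  have h : mfderiv 𝓘(ℝ, ℝ) 𝓘(ℝ, F) (fun s ↦ extChartAt 𝓘(ℝ, F) y₀ (c s)) t = _ :=
    mfderiv_comp t ((contMDiffAt_extChartAt_of_mem ht).mdifferentiableAt (by simp))
      (hc.contMDiffAt.mdifferentiableAt (by simp))
  rw [← fderiv_apply_one_eq_deriv, ← mfderiv_eq_fderiv, h]
  rfl

lemma deriv_extChartAt_comp_eq_zero_iff (hc : ContMDiff 𝓘(ℝ, ℝ) 𝓘(ℝ, F) ∞ c)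
    (ht : c t ∈ (extChartAt 𝓘(ℝ, F) y₀).source) :
    deriv (fun s ↦ extChartAt 𝓘(ℝ, F) y₀ (c s)) t = 0 ↔ mfderiv 𝓘(ℝ, ℝ) 𝓘(ℝ, F) c t = 0 := by
  rw [deriv_extChartAt_comp hc ht, mfderiv_curve_eq_zero_iff]
  exact map_eq_zero_iff _ (mfderiv_extChartAt_injective ht)

end Curves

/-! ### Ambient geodesics tangent to the kernel -/

section Geodesic

variable {E : Type*} [NormedAddCommGroup E] [NormedSpace ℝ E] [FiniteDimensional ℝ E]
  {M : Type u} [TopologicalSpace M] [ChartedSpace E M]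

/-- Time reversal changes the sign of `c'` but not of `c''`, and `Γ (c', c')` is quadratic. This
reduces negative times to positive ones. -/
lemma isGeodesic_comp_neg
    {g : ∀ x : M, TangentSpace 𝓘(ℝ, E) x →L[ℝ] TangentSpace 𝓘(ℝ, E) x →L[ℝ] ℝ} {γ : ℝ → M}
    (hγ : IsGeodesic g γ) : IsGeodesic g (fun t ↦ γ (-t)) := by
  refine ⟨hγ.contMDiff.comp (contMDiff_iff_contDiff.2 contDiff_neg), fun x₀ t ht ↦ ?_⟩
  have h1 : deriv (fun s ↦ extChartAt 𝓘(ℝ, E) x₀ (γ (-s))) =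
      fun s ↦ -deriv (fun s ↦ extChartAt 𝓘(ℝ, E) x₀ (γ s)) (-s) :=
    funext fun s ↦ deriv_comp_neg (fun s ↦ extChartAt 𝓘(ℝ, E) x₀ (γ s)) s
  have h2 := hγ.equation x₀ (-t) ht
  rw [h1, deriv.fun_neg, deriv_comp_neg, neg_neg]
  simp only [← christoffelBilin_apply, map_neg, neg_apply, neg_neg] at h2 ⊢
  exact h2

variable [IsManifold 𝓘(ℝ, E) ∞ M]
  {F : Type*} [NormedAddCommGroup F] [NormedSpace ℝ F] [FiniteDimensional ℝ F]
  {N : Type*} [TopologicalSpace N] [ChartedSpace F N] [IsManifold 𝓘(ℝ, F) ∞ N]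
  (g : Bundle.ContMDiffRiemannianMetric 𝓘(ℝ, E) ∞ E (fun x : M ↦ TangentSpace 𝓘(ℝ, E) x))
  {f : M → N} {γ : ℝ → M}

/-- Coordinates around a point of a geodesic, for a map with autoparallel kernel distribution. -/
lemma exists_geodesic_coordinates (hf : ContMDiff 𝓘(ℝ, E) 𝓘(ℝ, F) ∞ f)
    (hauto : IsAutoparallelOn g.inner (kerDistribution E F f) (maxRankSet E F f))
    {q : M} (hq : q ∈ maxRankSet E F f) (hγ : IsGeodesic g.inner γ) (b : ℝ) :
    ∃ (Ω : Set E) (h : E → F) (Γ : E → E →L[ℝ] E →L[ℝ] E) (z : ℝ → E × E), IsOpen Ω ∧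
      ContDiffOn ℝ ∞ h Ω ∧ ContDiffOn ℝ ∞ Γ Ω ∧
      (∀ x ∈ Ω, Module.finrank ℝ (fderiv ℝ h x).range ≤ rankAt E F f q) ∧
      (∀ x ∈ Ω, Module.finrank ℝ (fderiv ℝ h x).range = rankAt E F f q → ∀ u v,
        fderiv ℝ h x u = 0 → fderiv ℝ h x v = 0 → hessianAt h Γ x u v = 0) ∧
      (∀ᶠ t in 𝓝 b, HasDerivAt z (geodesicField Γ (z t)) t) ∧ (z b).1 ∈ Ω ∧
      ∀ᶠ t in 𝓝 b,
        (Module.finrank ℝ (fderiv ℝ h (z t).1).range = rankAt E F f q ↔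
          γ t ∈ maxRankSet E F f) ∧
        (differentialMap h (z t) = 0 ↔ mfderiv 𝓘(ℝ, ℝ) 𝓘(ℝ, F) (f ∘ γ) t = 0) := by
  set φ := extChartAt 𝓘(ℝ, E) (γ b) with hφ
  set ψ := extChartAt 𝓘(ℝ, F) (f (γ b)) with hψ
  set h := inCharts (K := E) (E := F) (γ b) (f (γ b)) f with hh
  have hmax : ∀ x, rankAt E F f x = rankAt E F f q ↔ x ∈ maxRankSet E F f :=
    fun x ↦ ⟨fun hx w ↦ (hq w).trans hx.ge, fun hx ↦ le_antisymm (hq x) (hx q)⟩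
  have hfγ : ContMDiff 𝓘(ℝ, ℝ) 𝓘(ℝ, F) ∞ (f ∘ γ) := hf.comp hγ.contMDiff
  let c : ℝ → E := fun s ↦ φ (γ s)
  have hnear : ∀ᶠ t in 𝓝 b, γ t ∈ φ.source ∧ f (γ t) ∈ ψ.source :=
    (hγ.contMDiff.continuous.continuousAt.eventually
      ((isOpen_extChartAt_source _).mem_nhds (mem_extChartAt_source (γ b)))).and
    (hfγ.continuous.continuousAt.eventually
      ((isOpen_extChartAt_source _).mem_nhds (mem_extChartAt_source (f (γ b)))))
  have hΩo : IsOpen (φ.target ∩ (f ∘ φ.symm) ⁻¹' ψ.source) :=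
    (hf.continuous.comp_continuousOn (continuousOn_extChartAt_symm (γ b))).isOpen_inter_preimage
      (isOpen_extChartAt_target _) (isOpen_extChartAt_source _)
  have hmem : ∀ t, γ t ∈ φ.source ∧ f (γ t) ∈ ψ.source →
      c t ∈ φ.target ∩ (f ∘ φ.symm) ⁻¹' ψ.source := by
    rintro t ⟨h1, h2⟩
    refine ⟨φ.map_source h1, ?_⟩
    simp only [mem_preimage, Function.comp_apply, c, φ.left_inv h1]
    exact h2
  -- The curve `z = (c, c')` turns the geodesic equation of second order into the flow of
  -- `geodesicField`.
  refine ⟨φ.target ∩ (f ∘ φ.symm) ⁻¹' ψ.source, h, christoffelBilin g.inner (γ b),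
    fun t ↦ (c t, deriv c t), hΩo, ?_, ?_, ?_, ?_, ?_, hmem b hnear.self_of_nhds, ?_⟩
  · exact fun x hx ↦ (contDiffAt_inCharts hx.1 hf.contMDiffAt hx.2).contDiffWithinAt
  · intro x hx
    exact (contDiffAt_christoffelBilin (isInvertible_of_pos fun v hv ↦ formInChart_pos g hx.1 hv)
      (contDiffAt_formInChart g hx.1)).contDiffWithinAt
  · intro x hx
    rw [finrank_range_fderiv_inCharts hf hx.1 hx.2]
    exact hq _
  · intro x hx hr u v hu hv
    rw [finrank_range_fderiv_inCharts hf hx.1 hx.2, hmax] at hr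
    exact hessianAt_eq_zero_of_isAutoparallelOn g hf hauto hx.1 hx.2 hr hu hv
  · filter_upwards [hnear] with t ht
    have hc : ContDiffAt ℝ ∞ c t := contDiffAt_extChartAt_comp hγ.contMDiff ht.1
    have hc' : ContDiffAt ℝ ∞ (deriv c) t := by
      have h1 : ContDiffAt ℝ ∞ (fderiv ℝ c) t := hc.fderiv_right (m := ∞) (by simp)
      exact h1.clm_apply contDiffAt_const
    have h1 := (hc.differentiableAt (by simp)).hasDerivAt.prodMk
      (hc'.differentiableAt (by simp)).hasDerivAt
    refine h1.congr_deriv ?_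
    have h2 := hγ.equation (γ b) t ht.1
    exact Prod.ext rfl (eq_neg_of_add_eq_zero_left h2)
  · filter_upwards [hnear, hnear.eventually_nhds] with t ht ht'
    have hl : φ.symm (c t) = γ t := φ.left_inv ht.1
    refine ⟨?_, ?_⟩
    · rw [finrank_range_fderiv_inCharts hf (hmem t ht).1 (hmem t ht).2, hmax, hl]
    · rw [← deriv_extChartAt_comp_eq_zero_iff hfγ ht.2]
      have hc : ContDiffAt ℝ ∞ c t := contDiffAt_extChartAt_comp hγ.contMDiff ht.1
      have hhc : ContDiffAt ℝ ∞ h (c t) :=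
        contDiffAt_inCharts (hmem t ht).1 hf.contMDiffAt (hmem t ht).2
      have h1 := (hhc.differentiableAt (by simp)).hasFDerivAt.comp_hasDerivAt t
        (hc.differentiableAt (by simp)).hasDerivAt
      have h2 : (fun s ↦ ψ ((f ∘ γ) s)) =ᶠ[𝓝 t] h ∘ c := by
        filter_upwards [ht'] with s hs
        exact congrArg (fun x ↦ ψ (f x)) (φ.left_inv hs.1).symm
      rw [h2.deriv_eq, h1.deriv]
      rfl

/-- A geodesic tangent to an autoparallel kernel distribution stays in the set of maximal rank, for
positive times. -/
lemma mem_maxRankSet_of_nonneg (hf : ContMDiff 𝓘(ℝ, E) 𝓘(ℝ, F) ∞ f)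
    (hauto : IsAutoparallelOn g.inner (kerDistribution E F f) (maxRankSet E F f))
    (hγ : IsGeodesic g.inner γ) (h0 : γ 0 ∈ maxRankSet E F f)
    (h0' : mfderiv 𝓘(ℝ, ℝ) 𝓘(ℝ, F) (f ∘ γ) 0 = 0) {t : ℝ} (ht : 0 ≤ t) :
    γ t ∈ maxRankSet E F f ∧ mfderiv 𝓘(ℝ, ℝ) 𝓘(ℝ, F) (f ∘ γ) t = 0 := by
  set A : Set ℝ := {t | γ t ∈ maxRankSet E F f ∧ mfderiv 𝓘(ℝ, ℝ) 𝓘(ℝ, F) (f ∘ γ) t = 0} with hA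
  have hopen : IsOpen A := by
    rw [isOpen_iff_mem_nhds]
    rintro b ⟨hb, hb'⟩
    obtain ⟨Ω, h, Γ, z, hΩ, hh, hΓ, hr, hH, hz, hzb, hev⟩ :=
      exists_geodesic_coordinates g hf hauto h0 hγ b
    filter_upwards [hev, eventually_differentialMap_eq_zero hΩ hh hΓ hr hH hz hzb
      (hev.self_of_nhds.1.2 hb) (hev.self_of_nhds.2.2 hb'),
      hγ.contMDiff.continuous.continuousAt ((isOpen_maxRankSet hf).mem_nhds hb)] with s hs hs1 hs2
    exact ⟨hs2, hs.2.1 hs1⟩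
  have hclosed : ∀ b, (∀ᶠ s in 𝓝[<] b, s ∈ A) → b ∈ A := by
    intro b hb
    obtain ⟨Ω, h, Γ, z, hΩ, hh, hΓ, hr, hH, hz, hzb, hev⟩ :=
      exists_geodesic_coordinates g hf hauto h0 hγ b
    have hleft : ∀ᶠ s in 𝓝[<] b, Module.finrank ℝ (fderiv ℝ h (z s).1).range = rankAt E F f (γ 0) ∧
        differentialMap h (z s) = 0 := by
      filter_upwards [hb, hev.filter_mono nhdsWithin_le_nhds] with s hs hs'
      exact ⟨hs'.1.2 hs.1, hs'.2.2 hs.2⟩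
    refine ⟨hev.self_of_nhds.1.1
      (finrank_range_eq_of_eventually_left hΩ hh hΓ hr hH hz hzb hleft), hev.self_of_nhds.2.1 ?_⟩
    have hcont : ContinuousAt (fun s ↦ differentialMap h (z s)) b :=
      (contDiffAt_differentialMap (hh.contDiffAt (hΩ.mem_nhds hzb))).continuousAt.comp (f := z)
        hz.self_of_nhds.continuousAt
    refine tendsto_nhds_unique (hcont.tendsto.mono_left (nhdsWithin_le_nhds (s := Iio b))) ?_
    exact tendsto_const_nhds.congr' (hleft.mono fun s hs ↦ hs.2.symm)
  by_contra hcon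
  set B : Set ℝ := {s | 0 ≤ s ∧ s ∉ A} with hB
  have hBne : B.Nonempty := ⟨t, ht, hcon⟩
  have hBbdd : BddBelow B := ⟨0, fun s hs ↦ hs.1⟩
  -- As `A` is open, the first bad time `b` exists and is bad. All times in `[0, b)` are good, so
  -- closedness from the left, `hclosed`, is enough for a contradiction.
  have hBc : IsClosed B := isClosed_Ici.inter hopen.isClosed_compl
  obtain ⟨hb0, hbA⟩ := hBc.csInf_mem hBne hBbdd
  set b := sInf B
  have hbpos : 0 < b := lt_of_le_of_ne hb0 fun h ↦ hbA (h ▸ ⟨h0, h0'⟩)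
  apply hbA
  apply hclosed
  filter_upwards [Ioo_mem_nhdsLT hbpos] with s hs
  by_contra hsA
  exact absurd (csInf_le hBbdd (show s ∈ B from ⟨hs.1.le, hsA⟩)) (not_le.2 hs.2)

/-- A geodesic tangent to an autoparallel kernel distribution stays in the set of maximal rank and
tangent to the distribution. -/
lemma mem_maxRankSet_of_isGeodesic (hf : ContMDiff 𝓘(ℝ, E) 𝓘(ℝ, F) ∞ f)
    (hauto : IsAutoparallelOn g.inner (kerDistribution E F f) (maxRankSet E F f))
    (hγ : IsGeodesic g.inner γ) (h0 : γ 0 ∈ maxRankSet E F f)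
    (h0' : mfderiv 𝓘(ℝ, ℝ) 𝓘(ℝ, F) (f ∘ γ) 0 = 0) (t : ℝ) :
    γ t ∈ maxRankSet E F f ∧ mfderiv 𝓘(ℝ, ℝ) 𝓘(ℝ, F) (f ∘ γ) t = 0 := by
  rcases le_total 0 t with ht | ht
  · exact mem_maxRankSet_of_nonneg g hf hauto hγ h0 h0' ht
  · have hfγ : ContMDiff 𝓘(ℝ, ℝ) 𝓘(ℝ, F) ∞ (f ∘ γ) := hf.comp hγ.contMDiff
    have hγ' := isGeodesic_comp_neg hγ
    have hfγ' : ContMDiff 𝓘(ℝ, ℝ) 𝓘(ℝ, F) ∞ (f ∘ fun t ↦ γ (-t)) := hf.comp hγ'.contMDiff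
    have h := mem_maxRankSet_of_nonneg g hf hauto hγ' (by simpa using h0)
      (mfderiv_comp_neg_eq_zero hfγ rfl neg_zero.symm h0') (neg_nonneg.2 ht)
    exact ⟨by simpa using h.1,
      mfderiv_comp_neg_eq_zero hfγ' (by funext s; simp) rfl h.2⟩

end Geodesic

/-- The constant rank theorem: near a point at which the rank of `h` is maximal, the fibers of `h`
are parametrized by open subsets of a vector space `K` of the dimension of the kernel. -/
lemma exists_fiber_parametrization {E F K : Type*} [NormedAddCommGroup E] [NormedSpace ℝ E]
    [FiniteDimensional ℝ E] [NormedAddCommGroup F] [NormedSpace ℝ F] [FiniteDimensional ℝ F]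
    [NormedAddCommGroup K] [NormedSpace ℝ K] [FiniteDimensional ℝ K]
    {h : E → F} {Ω : Set E} (hΩ : IsOpen Ω) (hh : ContDiffOn ℝ ∞ h Ω) {y₀ : E} (hy₀ : y₀ ∈ Ω)
    (hr : ∀ y ∈ Ω, Module.finrank ℝ (fderiv ℝ h y).range ≤
      Module.finrank ℝ (fderiv ℝ h y₀).range)
    (hK : Module.finrank ℝ K = Module.finrank ℝ (fderiv ℝ h y₀).ker) :
    ∃ (W : Set E) (V : Set K) (p : K → E) (ρ : E → K), IsOpen W ∧ y₀ ∈ W ∧ W ⊆ Ω ∧ IsOpen V ∧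
      IsPreconnected V ∧ ContDiffOn ℝ ∞ p V ∧ ContDiffOn ℝ ∞ ρ W ∧
      (∀ z ∈ V, p z ∈ W ∧ h (p z) = h y₀ ∧ ρ (p z) = z) ∧
      ∀ y ∈ W, h y = h y₀ → ρ y ∈ V ∧ p (ρ y) = y := by
  set A₀ := fderiv ℝ h y₀ with hA₀
  obtain ⟨R, hR⟩ := exists_generalized_inverse A₀
  have hhΩ : ∀ y ∈ Ω, ContDiffAt ℝ ∞ h y := fun y hy ↦ hh.contDiffAt (hΩ.mem_nhds hy)
  -- the coordinate change
  set Θ : E → E := fun y ↦ R (h y - h y₀) + ((y - y₀) - R (A₀ (y - y₀))) with hΘ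
  have hΘsm : ∀ y ∈ Ω, ContDiffAt ℝ ∞ Θ y := fun y hy ↦
    (R.contDiff.contDiffAt.comp y ((hhΩ y hy).sub contDiffAt_const)).add
      ((contDiffAt_id.sub contDiffAt_const).sub
        ((R ∘L A₀).contDiff.contDiffAt.comp y (contDiffAt_id.sub contDiffAt_const)))
  -- The differential of `Θ` is the identity at `y₀`, so `Θ` is a local diffeomorphism; it will
  -- straighten the fiber through `y₀` to `ker A₀`.
  have hΘd : ∀ y ∈ Ω, HasFDerivAt Θ (splitMap A₀ R (fderiv ℝ h y)) y := by
    intro y hy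
    have h1 : HasFDerivAt (fun y ↦ h y - h y₀) (fderiv ℝ h y) y :=
      ((hhΩ y hy).differentiableAt (by simp)).hasFDerivAt.sub_const _
    have h2 : HasFDerivAt (fun y ↦ y - y₀) (ContinuousLinearMap.id ℝ E) y :=
      (hasFDerivAt_id y).sub_const _
    exact (R.hasFDerivAt.comp y h1).add (h2.sub ((R ∘L A₀).hasFDerivAt.comp y h2))
  have hΘ0 : Θ y₀ = 0 := by simp [hΘ]
  have hd0 : HasFDerivAt Θ ((ContinuousLinearEquiv.refl ℝ E : E ≃L[ℝ] E) : E →L[ℝ] E) y₀ := by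
    have := hΘd y₀ hy₀
    rwa [splitMap_self] at this
  set e := (hΘsm y₀ hy₀).toOpenPartialHomeomorph Θ hd0 (by simp) with he
  have hey : ∀ y, e y = Θ y := fun y ↦ rfl
  have hes : y₀ ∈ e.source := ContDiffAt.mem_toOpenPartialHomeomorph_source ..
  have het : (0 : E) ∈ e.target := hΘ0 ▸ e.map_source hes
  have hes0 : e.symm 0 = y₀ := by rw [← hΘ0]; exact e.left_inv hes
  -- the domain
  have hgood : ∀ᶠ y in 𝓝 y₀, y ∈ Ω ∧ (splitMap A₀ R (fderiv ℝ h y)).IsInvertible := by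
    have hc : ContinuousAt (fun y ↦ splitMap A₀ R (fderiv ℝ h y)) y₀ :=
      (continuousAt_const.clm_comp ((hhΩ y₀ hy₀).fderiv_right (m := ∞)
        (by simp)).continuousAt).add continuousAt_const
    have hn : range ((↑) : (E ≃L[ℝ] E) → E →L[ℝ] E) ∈ 𝓝 (splitMap A₀ R (fderiv ℝ h y₀)) := by
      rw [splitMap_self]
      exact ContinuousLinearEquiv.nhds (ContinuousLinearEquiv.refl ℝ E)
    exact (hΩ.eventually_mem hy₀).and (hc hn)
  have hgood' : ∀ᶠ w in 𝓝 (0 : E), w ∈ e.target ∧ e.symm w ∈ Ω ∧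
      (splitMap A₀ R (fderiv ℝ h (e.symm w))).IsInvertible := by
    refine (e.open_target.eventually_mem het).and
      ((e.continuousAt_symm het).eventually
        (p := fun y ↦ y ∈ Ω ∧ (splitMap A₀ R (fderiv ℝ h y)).IsInvertible) ?_)
    rw [hes0]; exact hgood
  obtain ⟨ε, hε, hball⟩ := Metric.eventually_nhds_iff_ball.1 hgood'
  -- coordinates on the kernel
  let ι : K →L[ℝ] E := A₀.ker.subtypeL ∘L
    (ContinuousLinearEquiv.ofFinrankEq hK : K ≃L[ℝ] A₀.ker)
  have hι : ∀ z, A₀ (ι z) = 0 := fun z ↦ (ContinuousLinearEquiv.ofFinrankEq hK z).2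
  have hιsurj : ∀ w, A₀ w = 0 → ∃ z, ι z = w := fun w hw ↦
    ⟨(ContinuousLinearEquiv.ofFinrankEq hK).symm ⟨w, hw⟩, by simp [ι]⟩
  have hιinj : Function.Injective ι :=
    Subtype.val_injective.comp (ContinuousLinearEquiv.ofFinrankEq hK).injective
  obtain ⟨κ', hκ'⟩ := (ι : K →ₗ[ℝ] E).exists_leftInverse_of_injective
    (LinearMap.ker_eq_bot.2 hιinj)
  let κ : E →L[ℝ] K := LinearMap.toContinuousLinearMap κ'
  have hκ : ∀ z, κ (ι z) = z := fun z ↦ LinearMap.congr_fun hκ' z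
  set B := Metric.ball (0 : E) ε
  have hpsm : ∀ z ∈ ι ⁻¹' B, ContDiffAt ℝ ∞ (fun z ↦ e.symm (ι z)) z := by
    intro z hz
    obtain ⟨ht, hΩz, T, hT⟩ := hball _ hz
    have := e.contDiffAt_symm ht (f₀' := T) (hT ▸ hΘd _ hΩz) (hΘsm _ hΩz)
    exact this.comp z ι.contDiff.contDiffAt
  have hVo : IsOpen (ι ⁻¹' B) := Metric.isOpen_ball.preimage ι.continuous
  -- Taking a ball, hence a convex domain, keeps the slice connected; a slice will therefore lie in
  -- a single component of a fiber.
  have hVc : IsPreconnected (ι ⁻¹' B) :=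
    ((convex_ball (0 : E) ε).linear_preimage (ι : K →ₗ[ℝ] E)).isPreconnected
  have h0V : (0 : K) ∈ ι ⁻¹' B := by simpa [B] using hε
  -- Because the rank does not exceed that of `A₀`, a vector that `DΘ` sends into `ker A₀` lies in
  -- `ker Dh`. Hence `h` has zero differential along the slice `Θ⁻¹ (ker A₀)`.
  have hfib : ∀ z ∈ ι ⁻¹' B, h (e.symm (ι z)) = h y₀ := by
    have hder : ∀ z ∈ ι ⁻¹' B, HasFDerivAt (fun z ↦ h (e.symm (ι z))) (0 : K →L[ℝ] F) z := by
      intro z hz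
      obtain ⟨ht, hΩz, T, hT⟩ := hball _ hz
      have hpd := ((hpsm z hz).differentiableAt (by simp)).hasFDerivAt
      have h1 : HasFDerivAt (fun z ↦ h (e.symm (ι z))) _ z :=
        (((hhΩ _ hΩz).differentiableAt (by simp)).hasFDerivAt).comp z hpd
      refine h1.congr_fderiv ?_
      ext a
      have h2 := HasFDerivAt.comp (g := Θ) z (hΘd _ hΩz) hpd
      have h3 : Θ ∘ (fun z ↦ e.symm (ι z)) =ᶠ[𝓝 z] ι := by
        filter_upwards [hVo.mem_nhds hz] with w hw
        exact e.right_inv (hball _ hw).1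
      have h4 := DFunLike.congr_fun
        ((h2.congr_of_eventuallyEq h3.symm).unique ι.hasFDerivAt) a
      simp only [ContinuousLinearMap.comp_apply] at h4
      refine apply_eq_zero_of_apply_splitMap_eq_zero (A₀ := A₀) (R := R) hR ?_ (hr _ hΩz) ?_
      · rw [← hT]; exact T.injective
      · exact (congrArg A₀ h4).trans (hι a)
    intro z hz
    have := hVo.is_const_of_fderiv_eq_zero (𝕜 := ℝ) hVc
      (fun z hz ↦ (hder z hz).differentiableAt.differentiableWithinAt)
      (fun z hz ↦ (hder z hz).fderiv) hz h0V
    rw [this, map_zero, hes0]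
  refine ⟨e.source ∩ e ⁻¹' B, ι ⁻¹' B, fun z ↦ e.symm (ι z), fun y ↦ κ (Θ y),
    e.isOpen_inter_preimage Metric.isOpen_ball, ⟨hes, ?_⟩, ?_, hVo, hVc,
    fun z hz ↦ (hpsm z hz).contDiffWithinAt, ?_, ?_, ?_⟩
  · rw [mem_preimage, hey, hΘ0]; exact Metric.mem_ball_self hε
  · rintro y ⟨hy, hyB⟩
    have := (hball _ hyB).2.1
    rwa [e.left_inv hy] at this
  · rintro y ⟨hy, hyB⟩
    have h1 := (hball _ hyB).2.1
    rw [e.left_inv hy] at h1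
    exact (κ.contDiff.contDiffAt.comp y (hΘsm y h1)).contDiffWithinAt
  · intro z hz
    have ht := (hball _ hz).1
    have hr : Θ (e.symm (ι z)) = ι z := e.right_inv ht
    refine ⟨⟨e.map_target ht, ?_⟩, hfib z hz, ?_⟩
    · rw [mem_preimage, e.right_inv ht]; exact hz
    · change κ (Θ (e.symm (ι z))) = z
      rw [hr, hκ]
  · rintro y ⟨hy, hyB⟩ hfy
    -- Where `h y = h y₀`, the first term of `Θ y` drops out and what remains, `(1 - R A₀) (y -
    -- y₀)`, lies in `ker A₀`.
    obtain ⟨z, hz⟩ := hιsurj (Θ y) (by simp [hΘ, hfy, hR])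
    change κ (Θ y) ∈ ι ⁻¹' B ∧ e.symm (ι (κ (Θ y))) = y
    rw [← hz, hκ]
    refine ⟨?_, ?_⟩
    · rw [mem_preimage, hz]; exact hyB
    · rw [hz]; exact e.left_inv hy

/-! ### Manifold structures from slice charts -/

section Slice

variable {E : Type*} [NormedAddCommGroup E] [NormedSpace ℝ E]
  {M : Type u} [TopologicalSpace M] [ChartedSpace E M]
  {K : Type*} [NormedAddCommGroup K] [NormedSpace ℝ K]

/-- A smooth parametrization `param` by an open set of the vector space `K` of an open subset
`C ∩ nhd` of `C`, together with a smooth left inverse `coord` on an open set of `M`. -/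
structure SliceChart (E : Type*) [NormedAddCommGroup E] [NormedSpace ℝ E]
    {M : Type u} [TopologicalSpace M] [ChartedSpace E M]
    (K : Type*) [NormedAddCommGroup K] [NormedSpace ℝ K] (C : Set M) where
  /-- the open subset of `M` -/
  nhd : Set M
  /-- the domain of the parametrization -/
  dom : Set K
  /-- the parametrization -/
  param : K → M
  /-- the left inverse of the parametrization -/
  coord : M → K
  isOpen_nhd : IsOpen nhd
  isOpen_dom : IsOpen dom
  contMDiffOn_param : ContMDiffOn 𝓘(ℝ, K) 𝓘(ℝ, E) ∞ param dom
  contMDiffOn_coord : ContMDiffOn 𝓘(ℝ, E) 𝓘(ℝ, K) ∞ coord nhd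
  param_mem : ∀ z ∈ dom, param z ∈ C ∧ param z ∈ nhd
  coord_param : ∀ z ∈ dom, coord (param z) = z
  coord_mem : ∀ y ∈ C, y ∈ nhd → coord y ∈ dom
  param_coord : ∀ y ∈ C, y ∈ nhd → param (coord y) = y

namespace SliceChart

variable {C : Set M}

open Classical in
/-- The chart of the subspace `C` that is given by a slice chart. -/
def toOpenPartialHomeomorph (s : SliceChart E K C) (x : C) : OpenPartialHomeomorph C K where
  toFun y := s.coord y
  -- The point `x` is only a default value, never taken on `dom`.
  invFun z := if h : s.param z ∈ C then ⟨s.param z, h⟩ else x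
  source := {y | (y : M) ∈ s.nhd}
  target := s.dom
  map_source' y hy := s.coord_mem y y.2 hy
  map_target' z hz := by
    simp only [(s.param_mem z hz).1, dif_pos, mem_ofPred_eq]
    exact (s.param_mem z hz).2
  left_inv' y hy := by
    have h := s.param_coord y y.2 hy
    simp [h]
  right_inv' z hz := by
    simp only [(s.param_mem z hz).1, dif_pos]
    exact s.coord_param z hz
  open_source := s.isOpen_nhd.preimage continuous_subtype_val
  open_target := s.isOpen_dom
  continuousOn_toFun := s.contMDiffOn_coord.continuousOn.comp continuous_subtype_val.continuousOn
    fun _ h ↦ h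
  continuousOn_invFun := by
    rw [Topology.IsInducing.subtypeVal.continuousOn_iff]
    refine s.contMDiffOn_param.continuousOn.congr fun z hz ↦ ?_
    simp [(s.param_mem z hz).1]

lemma coe_toOpenPartialHomeomorph_symm_apply (s : SliceChart E K C) (x : C) {z : K}
    (hz : z ∈ s.dom) : ((s.toOpenPartialHomeomorph x).symm z : M) = s.param z :=
  congrArg Subtype.val (dif_pos (s.param_mem z hz).1)

/-- The charted space structure on `C` given by a family of slice charts. -/
abbrev chartedSpace (s : C → SliceChart E K C) (hs : ∀ x : C, (x : M) ∈ (s x).nhd) :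
    ChartedSpace K C where
  atlas := range fun x ↦ (s x).toOpenPartialHomeomorph x
  chartAt x := (s x).toOpenPartialHomeomorph x
  mem_chart_source := hs
  chart_mem_atlas x := mem_range_self x

variable (s : C → SliceChart E K C) (hs : ∀ x : C, (x : M) ∈ (s x).nhd)

/-- A transition map is a `param` followed by a `coord`, so it factors smoothly through `M`. -/
lemma isManifold : letI := chartedSpace s hs; IsManifold 𝓘(ℝ, K) ∞ C := by
  let := chartedSpace s hs
  apply isManifold_of_contDiffOn
  rintro _ _ ⟨x, rfl⟩ ⟨x', rfl⟩
  simp only [modelWithCornersSelf_coe, modelWithCornersSelf_coe_symm, Function.id_comp,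
    Function.comp_id, preimage_id, range_id, inter_univ]
  have h1 : ContMDiffOn 𝓘(ℝ, K) 𝓘(ℝ, K) ∞ ((s x').coord ∘ (s x).param)
      ((s x).dom ∩ (s x).param ⁻¹' (s x').nhd) :=
    (s x').contMDiffOn_coord.comp ((s x).contMDiffOn_param.mono inter_subset_left)
      fun z hz ↦ hz.2
  refine (contMDiffOn_iff_contDiffOn.1 h1).congr_mono ?_ ?_
  · rintro z ⟨hz, hz'⟩
    exact congrArg (s x').coord (coe_toOpenPartialHomeomorph_symm_apply (s x) x hz)
  · rintro z ⟨hz, hz'⟩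
    refine ⟨hz, ?_⟩
    rw [mem_preimage, ← coe_toOpenPartialHomeomorph_symm_apply (s x) x hz]
    exact hz'

lemma contMDiff_coe : letI := chartedSpace s hs;
    ContMDiff 𝓘(ℝ, K) 𝓘(ℝ, E) ∞ (Subtype.val : C → M) := by
  let := chartedSpace s hs
  have := isManifold s hs
  intro x
  have h1 : ContMDiffAt 𝓘(ℝ, K) 𝓘(ℝ, K) ∞ (chartAt K x) x :=
    contMDiffOn_chart.contMDiffAt ((chartAt K x).open_source.mem_nhds (mem_chart_source K x))
  have hd : (s x).coord x ∈ (s x).dom := (s x).coord_mem x x.2 (hs x)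
  have h2 : ContMDiffAt 𝓘(ℝ, K) 𝓘(ℝ, E) ∞ (s x).param (chartAt K x x) :=
    (s x).contMDiffOn_param.contMDiffAt ((s x).isOpen_dom.mem_nhds hd)
  refine (h2.comp x h1).congr_of_eventuallyEq ?_
  filter_upwards [(chartAt K x).open_source.mem_nhds (mem_chart_source K x)] with y hy
  exact ((s x).param_coord y y.2 hy).symm

/-- The chart at `x` is `coord` composed with the inclusion, and its differential is injective. -/
lemma injective_mfderiv_coe (x : C) : letI := chartedSpace s hs;
    Function.Injective (mfderiv 𝓘(ℝ, K) 𝓘(ℝ, E) (Subtype.val : C → M) x) := by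
  let := chartedSpace s hs
  have := isManifold s hs
  have h1 : MDifferentiableAt 𝓘(ℝ, E) 𝓘(ℝ, K) (s x).coord (x : M) :=
    ((s x).contMDiffOn_coord.contMDiffAt ((s x).isOpen_nhd.mem_nhds (hs x))).mdifferentiableAt
      (by simp)
  have h2 : mfderiv 𝓘(ℝ, K) 𝓘(ℝ, K) (extChartAt 𝓘(ℝ, K) x) x = _ :=
    mfderiv_comp (g := (s x).coord) (f := (Subtype.val : C → M)) x h1
      ((contMDiff_coe s hs).contMDiffAt.mdifferentiableAt (by simp))
  have h3 := mfderiv_extChartAt_injective (mem_extChartAt_source (I := 𝓘(ℝ, K)) x)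
  intro a b hab
  apply h3
  rw [h2]
  exact congrArg (mfderiv 𝓘(ℝ, E) 𝓘(ℝ, K) (s x).coord (x : M)) hab

end SliceChart

end Slice

/-! ### Integral manifolds of the kernel distribution -/

section Kernel

variable {E : Type*} [NormedAddCommGroup E] [NormedSpace ℝ E]
  {M : Type u} [TopologicalSpace M] [ChartedSpace E M]
  {F : Type*} [NormedAddCommGroup F] [NormedSpace ℝ F]
  {N : Type v} [TopologicalSpace N] [ChartedSpace F N]
  {K : Type*} [NormedAddCommGroup K] [NormedSpace ℝ K]
  {L : Type u} [TopologicalSpace L] [ChartedSpace K L] {j : L → M} {f : M → N}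

lemma mfderiv_extChartAt_symm_injective [IsManifold 𝓘(ℝ, E) ∞ M] {x₀ : M} {y : E}
    (hy : y ∈ (extChartAt 𝓘(ℝ, E) x₀).target) :
    Function.Injective (mfderiv 𝓘(ℝ, E) 𝓘(ℝ, E) (extChartAt 𝓘(ℝ, E) x₀).symm y) := by
  intro a b hab
  have h2 := mfderiv_extChartAt_comp_symm hy
  have h3 := congrArg (mfderiv 𝓘(ℝ, E) 𝓘(ℝ, E) (extChartAt 𝓘(ℝ, E) x₀)
    ((extChartAt 𝓘(ℝ, E) x₀).symm y)) hab
  exact (DFunLike.congr_fun h2 a).symm.trans (h3.trans (DFunLike.congr_fun h2 b))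

lemma rankAt_eq_of_mem_maxRankSet {x y : M} (hx : x ∈ maxRankSet E F f)
    (hy : y ∈ maxRankSet E F f) : rankAt E F f x = rankAt E F f y :=
  le_antisymm (hy x) (hx y)

lemma mfderiv_apply_mfderiv_of_isIntegralManifold
    (hj : IsIntegralManifold K (kerDistribution E F f) (maxRankSet E F f) j) (q : L)
    (v : TangentSpace 𝓘(ℝ, K) q) :
    mfderiv 𝓘(ℝ, E) 𝓘(ℝ, F) f (j q) (mfderiv 𝓘(ℝ, K) 𝓘(ℝ, E) j q v) = 0 := by
  have h : mfderiv 𝓘(ℝ, K) 𝓘(ℝ, E) j q v ∈ kerDistribution E F f (j q) := by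
    rw [← hj.range_mfderiv q]
    exact ⟨v, rfl⟩
  exact h

lemma apply_eq_of_isIntegralManifold [IsManifold 𝓘(ℝ, F) ∞ N] [IsManifold 𝓘(ℝ, K) ∞ L]
    (hf : ContMDiff 𝓘(ℝ, E) 𝓘(ℝ, F) ∞ f)
    (hj : IsIntegralManifold K (kerDistribution E F f) (maxRankSet E F f) j) (p q : L) :
    f (j p) = f (j q) := by
  have := hj.connected
  refine eq_of_mfderiv_eq_zero (f := f ∘ j) (hf.comp hj.contMDiff) (fun q ↦ ?_) p q
  rw [mfderiv_comp q (hf.contMDiffAt.mdifferentiableAt (by simp))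
    (hj.contMDiff.contMDiffAt.mdifferentiableAt (by simp))]
  exact ContinuousLinearMap.ext fun v ↦ mfderiv_apply_mfderiv_of_isIntegralManifold hj q v

variable [FiniteDimensional ℝ E]

/-- Rank–nullity at `j q`, and the rank is constant on `U`. The existence of one leaf modelled on
`K` makes `K` the right model for all slices of fibers in `U`. -/
lemma finrank_add_rankAt_of_isIntegralManifold
    (hj : IsIntegralManifold K (kerDistribution E F f) (maxRankSet E F f) j) (q : L) {x : M}
    (hx : x ∈ maxRankSet E F f) :
    Module.finrank ℝ K + rankAt E F f x = Module.finrank ℝ E := by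
  rw [rankAt_eq_of_mem_maxRankSet hx (hj.mem q)]
  let A : K →L[ℝ] E := mfderiv 𝓘(ℝ, K) 𝓘(ℝ, E) j q
  let B : E →L[ℝ] F := mfderiv 𝓘(ℝ, E) 𝓘(ℝ, F) f (j q)
  have hAB : A.range = B.ker := hj.range_mfderiv q
  have h3 : Module.finrank ℝ A.range = Module.finrank ℝ K :=
    LinearMap.finrank_range_of_inj (hj.injective_mfderiv q)
  have h4 := finrank_range_add_finrank_ker' B
  change Module.finrank ℝ K + Module.finrank ℝ B.range = _
  rw [hAB] at h3
  omega

/-- A component of a fiber of `f` in the set of points of maximal rank is an integral manifold. -/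
lemma isIntegralManifold_coe (hf : ContMDiff 𝓘(ℝ, E) 𝓘(ℝ, F) ∞ f) {x₀ : M}
    (hx₀ : x₀ ∈ maxRankSet E F f)
    (hK : ∀ x ∈ maxRankSet E F f, Module.finrank ℝ K + rankAt E F f x = Module.finrank ℝ E)
    (s : connectedComponentIn (maxRankSet E F f ∩ f ⁻¹' {f x₀}) x₀ →
      SliceChart E K (connectedComponentIn (maxRankSet E F f ∩ f ⁻¹' {f x₀}) x₀))
    (hs : ∀ x, (x : M) ∈ (s x).nhd) :
    letI := SliceChart.chartedSpace s hs
    IsIntegralManifold K (kerDistribution E F f) (maxRankSet E F f)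
      (Subtype.val : connectedComponentIn (maxRankSet E F f ∩ f ⁻¹' {f x₀}) x₀ → M) := by
  let := SliceChart.chartedSpace s hs
  have hinj := SliceChart.injective_mfderiv_coe s hs
  have hsm := SliceChart.contMDiff_coe s hs
  have hsub := connectedComponentIn_subset (maxRankSet E F f ∩ f ⁻¹' {f x₀}) x₀
  refine ⟨isConnected_iff_connectedSpace.1 (isConnected_connectedComponentIn_iff.2 ⟨hx₀, rfl⟩),
    hsm, Subtype.val_injective, hinj, fun q ↦ (hsub q.2).1, fun q ↦ ?_⟩
  have h1 : mfderiv 𝓘(ℝ, K) 𝓘(ℝ, F) (f ∘ (Subtype.val :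
      connectedComponentIn (maxRankSet E F f ∩ f ⁻¹' {f x₀}) x₀ → M)) q = _ :=
    mfderiv_comp q (hf.contMDiffAt.mdifferentiableAt (by simp))
      (hsm.contMDiffAt.mdifferentiableAt (by simp))
  have h2 : f ∘ (Subtype.val :
      connectedComponentIn (maxRankSet E F f ∩ f ⁻¹' {f x₀}) x₀ → M) = fun _ ↦ f x₀ :=
    funext fun q ↦ (hsub q.2).2
  rw [h2, mfderiv_const] at h1
  let A : K →L[ℝ] E := mfderiv 𝓘(ℝ, K) 𝓘(ℝ, E) (Subtype.val :
      connectedComponentIn (maxRankSet E F f ∩ f ⁻¹' {f x₀}) x₀ → M) q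
  let B : E →L[ℝ] F := mfderiv 𝓘(ℝ, E) 𝓘(ℝ, F) f q
  have hA : Function.Injective A := hinj q
  change A.range = B.ker
  refine Submodule.eq_of_le_of_finrank_eq ?_ ?_
  · rintro _ ⟨v, rfl⟩
    exact (DFunLike.congr_fun h1 v).symm
  · have h3 : Module.finrank ℝ A.range = Module.finrank ℝ K := LinearMap.finrank_range_of_inj hA
    have h4 := finrank_range_add_finrank_ker' B
    have h5 := hK _ (hsub q.2).1
    change Module.finrank ℝ K + Module.finrank ℝ B.range = _ at h5
    omega

end Kernel

/-! ### Maximal leaves are components of fibers -/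

section Leaf

variable {E : Type*} [NormedAddCommGroup E] [NormedSpace ℝ E] [FiniteDimensional ℝ E]
  {M : Type u} [TopologicalSpace M] [ChartedSpace E M] [IsManifold 𝓘(ℝ, E) ∞ M]
  {F : Type*} [NormedAddCommGroup F] [NormedSpace ℝ F] [FiniteDimensional ℝ F]
  {N : Type v} [TopologicalSpace N] [ChartedSpace F N] [IsManifold 𝓘(ℝ, F) ∞ N]
  {K : Type*} [NormedAddCommGroup K] [NormedSpace ℝ K] [FiniteDimensional ℝ K]
  {f : M → N}

/-- The constant rank theorem on manifolds: near a point of maximal rank, the fibers of `f` are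
parametrized by open subsets of a vector space `K` of the dimension of the kernel. -/
lemma exists_fiber_parametrization_of_mem_maxRankSet (hf : ContMDiff 𝓘(ℝ, E) 𝓘(ℝ, F) ∞ f) {x : M}
    (hx : x ∈ maxRankSet E F f)
    (hK : Module.finrank ℝ K + rankAt E F f x = Module.finrank ℝ E) :
    ∃ (W : Set M) (V : Set K) (p : K → M) (ρ : M → K), IsOpen W ∧ x ∈ W ∧ W ⊆ maxRankSet E F f ∧
      IsOpen V ∧ IsPreconnected V ∧ ContMDiffOn 𝓘(ℝ, K) 𝓘(ℝ, E) ∞ p V ∧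
      ContMDiffOn 𝓘(ℝ, E) 𝓘(ℝ, K) ∞ ρ W ∧
      (∀ z ∈ V, p z ∈ W ∧ f (p z) = f x ∧ ρ (p z) = z) ∧
      ∀ y ∈ W, f y = f x → ρ y ∈ V ∧ p (ρ y) = y := by
  set φ := extChartAt 𝓘(ℝ, E) x with hφ
  set ψ := extChartAt 𝓘(ℝ, F) (f x) with hψ
  set h : E → F := inCharts x (f x) f with hh
  have hxs : x ∈ φ.source := mem_extChartAt_source (I := 𝓘(ℝ, E)) x
  have hfx : f x ∈ ψ.source := mem_extChartAt_source (I := 𝓘(ℝ, F)) (f x)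
  have hl : φ.symm (φ x) = x := φ.left_inv hxs
  set Ω : Set E := φ.target ∩ φ.symm ⁻¹' (maxRankSet E F f ∩ f ⁻¹' ψ.source) with hΩ
  have hΩo : IsOpen Ω := (continuousOn_extChartAt_symm x).isOpen_inter_preimage
    (isOpen_extChartAt_target x)
    ((isOpen_maxRankSet hf).inter ((isOpen_extChartAt_source (f x)).preimage hf.continuous))
  have hxΩ : φ x ∈ Ω := ⟨φ.map_source hxs, by rw [mem_preimage, hl]; exact ⟨hx, hfx⟩⟩
  have hrank : ∀ y ∈ Ω, Module.finrank ℝ (fderiv ℝ h y).range = rankAt E F f (φ.symm y) :=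
    fun y hy ↦ finrank_range_fderiv_inCharts hf hy.1 hy.2.2
  have hrx : Module.finrank ℝ (fderiv ℝ h (φ x)).range = rankAt E F f x := by
    rw [hrank _ hxΩ, hl]
  obtain ⟨W, V, p, ρ, hWo, hxW, hWΩ, hVo, hVc, hp, hρ, hpW, hWp⟩ :=
    exists_fiber_parametrization (h := h) (K := K) hΩo
      (fun y hy ↦ (contDiffAt_inCharts hy.1 hf.contMDiffAt hy.2.2).contDiffWithinAt) hxΩ
      (fun y hy ↦ by rw [hrank y hy, hrx]; exact hx _)
      (by
        have := finrank_range_add_finrank_ker' (fderiv ℝ h (φ x))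
        omega)
  have hhx : h (φ x) = ψ (f x) := congrArg (fun a ↦ ψ (f a)) hl
  refine ⟨φ.source ∩ φ ⁻¹' W, V, φ.symm ∘ p, ρ ∘ φ,
    (continuousOn_extChartAt x).isOpen_inter_preimage (isOpen_extChartAt_source x) hWo,
    ⟨hxs, hxW⟩, ?_, hVo, hVc, ?_, ?_, ?_, ?_⟩
  · rintro y ⟨hy, hyW⟩
    have := (hWΩ hyW).2.1
    rwa [φ.left_inv hy] at this
  · exact (contMDiffOn_extChartAt_symm x).comp (contMDiffOn_iff_contDiffOn.2 hp)
      fun z hz ↦ (hWΩ (hpW z hz).1).1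
  · exact (contMDiffOn_iff_contDiffOn.2 hρ).comp
      (fun y hy ↦ (contMDiffAt_extChartAt_of_mem hy.1).contMDiffWithinAt) fun y hy ↦ hy.2
  · intro z hz
    obtain ⟨h1, h2, h3⟩ := hpW z hz
    have h4 := hWΩ h1
    refine ⟨⟨φ.map_target h4.1, ?_⟩, ψ.injOn h4.2.2 hfx (h2.trans hhx), ?_⟩
    · change φ (φ.symm (p z)) ∈ W
      rwa [φ.right_inv h4.1]
    · change ρ (φ (φ.symm (p z))) = z
      rwa [φ.right_inv h4.1]
  · rintro y ⟨hy, hyW⟩ hfy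
    obtain ⟨h1, h2⟩ := hWp _ hyW ((congrArg (fun a ↦ ψ (f a)) (φ.left_inv hy)).trans
      ((congrArg ψ hfy).trans hhx.symm))
    refine ⟨h1, ?_⟩
    change φ.symm (p (ρ (φ y))) = y
    rw [h2, φ.left_inv hy]

/-- The components of the fibers of `f` in the set of points of maximal rank have slice charts. -/
lemma exists_sliceChart (hf : ContMDiff 𝓘(ℝ, E) 𝓘(ℝ, F) ∞ f) {x₀ : M}
    (hK : ∀ x ∈ maxRankSet E F f, Module.finrank ℝ K + rankAt E F f x = Module.finrank ℝ E)
    (x : connectedComponentIn (maxRankSet E F f ∩ f ⁻¹' {f x₀}) x₀) :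
    ∃ s : SliceChart E K (connectedComponentIn (maxRankSet E F f ∩ f ⁻¹' {f x₀}) x₀),
      (x : M) ∈ s.nhd := by
  obtain ⟨x, hx⟩ := x
  have hS := connectedComponentIn_subset _ _ hx
  have hfx : f x = f x₀ := hS.2
  obtain ⟨W, V, p, ρ, hWo, hxW, hWU, hVo, hVc, hp, hρ, hpW, hWp⟩ :=
    exists_fiber_parametrization_of_mem_maxRankSet (K := K) hf hS.1 (hK x hS.1)
  -- The slice is connected, lies in the fiber and passes through `x`, so it belongs to the
  -- component of `x`.
  have hpV : p '' V ⊆ connectedComponentIn (maxRankSet E F f ∩ f ⁻¹' {f x₀}) x₀ := by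
    rw [connectedComponentIn_eq hx]
    refine (hVc.image p hp.continuousOn).subset_connectedComponentIn
      ⟨ρ x, (hWp x hxW rfl).1, (hWp x hxW rfl).2⟩ ?_
    rintro _ ⟨z, hz, rfl⟩
    exact ⟨hWU (hpW z hz).1, (hpW z hz).2.1.trans hfx⟩
  have hfib : ∀ y ∈ connectedComponentIn (maxRankSet E F f ∩ f ⁻¹' {f x₀}) x₀, f y = f x :=
    fun y hy ↦ (connectedComponentIn_subset _ _ hy).2.trans hfx.symm
  exact ⟨{
    nhd := W
    dom := V
    param := p
    coord := ρ
    isOpen_nhd := hWo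
    isOpen_dom := hVo
    contMDiffOn_param := hp
    contMDiffOn_coord := hρ
    param_mem := fun z hz ↦ ⟨hpV (mem_image_of_mem p hz), (hpW z hz).1⟩
    coord_param := fun z hz ↦ (hpW z hz).2.2
    coord_mem := fun y hy hyW ↦ (hWp y hyW (hfib y hy)).1
    param_coord := fun y hy hyW ↦ (hWp y hyW (hfib y hy)).2 }, hxW⟩

variable {L : Type u} [TopologicalSpace L] [ChartedSpace K L]
  [IsManifold 𝓘(ℝ, K) ∞ L] {j : L → M}

/-- A maximal integral manifold is a component of a fiber of `f` in the set of points of maximal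
rank. -/
lemma range_eq_connectedComponentIn (hf : ContMDiff 𝓘(ℝ, E) 𝓘(ℝ, F) ∞ f)
    (hj : IsMaximalIntegralManifold K (kerDistribution E F f) (maxRankSet E F f) j) (q : L) :
    range j = connectedComponentIn (maxRankSet E F f ∩ f ⁻¹' {f (j q)}) (j q) := by
  have := hj.1.connected
  have hK := fun x hx ↦ finrank_add_rankAt_of_isIntegralManifold hj.1 q (x := x) hx
  choose s hs using exists_sliceChart (K := K) hf (x₀ := j q) hK
  let := SliceChart.chartedSpace s hs
  have := SliceChart.isManifold s hs
  -- Maximality is tested against the component itself, which contains the connected set `range j`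
  -- because `f ∘ j` is constant.
  have h1 := hj.2 _ _ (isIntegralManifold_coe hf (hj.1.mem q) hK s hs)
  rw [Subtype.range_coe] at h1
  refine (h1 ?_).symm
  refine (isPreconnected_range hj.1.contMDiff.continuous).subset_connectedComponentIn
    (mem_range_self q) ?_
  rintro _ ⟨p, rfl⟩
  exact ⟨hj.1.mem p, apply_eq_of_isIntegralManifold hf hj.1 p q⟩

/-- An integral manifold has smooth local inverses defined on open subsets of `M`. -/
lemma exists_local_inverse (hf : ContMDiff 𝓘(ℝ, E) 𝓘(ℝ, F) ∞ f)
    (hj : IsIntegralManifold K (kerDistribution E F f) (maxRankSet E F f) j) (q : L) :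
    ∃ τ : M → L, ContMDiffAt 𝓘(ℝ, E) 𝓘(ℝ, K) ∞ τ (j q) ∧
      ∀ᶠ y in 𝓝 (j q), f y = f (j q) → j (τ y) = y := by
  obtain ⟨W, V, p, ρ, hWo, hxW, hWU, hVo, hVc, hp, hρ, hpW, hWp⟩ :=
    exists_fiber_parametrization_of_mem_maxRankSet (K := K) hf (hj.mem q)
      (finrank_add_rankAt_of_isIntegralManifold hj q (hj.mem q))
  set φ := extChartAt 𝓘(ℝ, K) q with hφ
  have hqs : q ∈ φ.source := mem_extChartAt_source (I := 𝓘(ℝ, K)) q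
  have hl : φ.symm (φ q) = q := φ.left_inv hqs
  have hjq : ContMDiffAt 𝓘(ℝ, K) 𝓘(ℝ, E) ∞ j q := hj.contMDiff.contMDiffAt
  have hρx : ContMDiffAt 𝓘(ℝ, E) 𝓘(ℝ, K) ∞ ρ (j q) := hρ.contMDiffAt (hWo.mem_nhds hxW)
  have hα : ContMDiffAt 𝓘(ℝ, K) 𝓘(ℝ, K) ∞ (ρ ∘ j) q := hρx.comp q hjq
  have hpx : ContMDiffAt 𝓘(ℝ, K) 𝓘(ℝ, E) ∞ p ((ρ ∘ j) q) :=
    hp.contMDiffAt (hVo.mem_nhds (hWp _ hxW rfl).1)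
  -- Near `q` one has `p ∘ (ρ ∘ j) = j`, and `j` is an immersion. Since `L` is modelled on `K` too,
  -- `ρ ∘ j` is a local diffeomorphism, and `τ` is its local inverse after `ρ`.
  have hαinj : Function.Injective (mfderiv 𝓘(ℝ, K) 𝓘(ℝ, K) (ρ ∘ j) q) := by
    have h1 : p ∘ (ρ ∘ j) =ᶠ[𝓝 q] j := by
      filter_upwards [hj.contMDiff.continuous.continuousAt (hWo.mem_nhds hxW)] with q' hq'
      exact (hWp _ hq' (apply_eq_of_isIntegralManifold hf hj q' q)).2
    have h2 : mfderiv 𝓘(ℝ, K) 𝓘(ℝ, E) (p ∘ (ρ ∘ j)) q = _ :=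
      mfderiv_comp q (hpx.mdifferentiableAt (by simp)) (hα.mdifferentiableAt (by simp))
    intro a b hab
    refine hj.injective_mfderiv q ?_
    rw [← h1.mfderiv_eq, h2]
    exact congrArg (mfderiv 𝓘(ℝ, K) 𝓘(ℝ, E) p ((ρ ∘ j) q)) hab
  set β : K → K := (ρ ∘ j) ∘ φ.symm with hβ
  have hα' : ContMDiffAt 𝓘(ℝ, K) 𝓘(ℝ, K) ∞ (ρ ∘ j) (φ.symm (φ q)) := hl.symm ▸ hα
  have hβsm : ContDiffAt ℝ ∞ β (φ q) := contMDiffAt_iff_contDiffAt.1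
    (contMDiffAt_comp_extChartAt_symm (φ.map_source hqs) hα')
  have hβinj : Function.Injective (fderiv ℝ β (φ q)) := by
    have h1 : mfderiv 𝓘(ℝ, K) 𝓘(ℝ, K) β (φ q) = _ :=
      mfderiv_comp (φ q) (hα'.mdifferentiableAt (by simp))
        ((contMDiffAt_extChartAt_symm (φ.map_source hqs)).mdifferentiableAt (by simp))
    rw [← mfderiv_eq_fderiv, h1]
    have hA : Function.Injective (mfderiv 𝓘(ℝ, K) 𝓘(ℝ, K) (ρ ∘ j) (φ.symm (φ q))) := by
      let D : L → K →L[ℝ] K := fun x ↦ mfderiv 𝓘(ℝ, K) 𝓘(ℝ, K) (ρ ∘ j) x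
      change Function.Injective (D (φ.symm (φ q)))
      rw [hl]
      exact hαinj
    have hB : Function.Injective (mfderiv 𝓘(ℝ, K) 𝓘(ℝ, K) φ.symm (φ q)) :=
      mfderiv_extChartAt_symm_injective (φ.map_source hqs)
    exact fun a b hab ↦ hB (hA hab)
  let T : K ≃L[ℝ] K :=
    (LinearEquiv.ofInjectiveEndo (fderiv ℝ β (φ q)).toLinearMap hβinj).toContinuousLinearEquiv
  have hT : HasFDerivAt β (T : K →L[ℝ] K) (φ q) := (hβsm.differentiableAt (by simp)).hasFDerivAt
  set e := hβsm.toOpenPartialHomeomorph β hT (by simp) with he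
  have hes : φ q ∈ e.source := ContDiffAt.mem_toOpenPartialHomeomorph_source ..
  have hβq : β (φ q) = ρ (j q) := congrArg (ρ ∘ j) hl
  have het : ρ (j q) ∈ e.target := hβq ▸ e.map_source hes
  have hsymm : e.symm (ρ (j q)) = φ q := by rw [← hβq]; exact e.left_inv hes
  have hesm : ContDiffAt ℝ ∞ e.symm (ρ (j q)) := by
    refine e.contDiffAt_symm (f₀' := T) het ?_ ?_
    · rw [hsymm]; exact hT
    · rw [hsymm]; exact hβsm
  have hφsm : ContMDiffAt 𝓘(ℝ, K) 𝓘(ℝ, K) ∞ φ.symm (e.symm (ρ (j q))) := by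
    rw [hsymm]; exact contMDiffAt_extChartAt_symm (φ.map_source hqs)
  have hτ : ContMDiffAt 𝓘(ℝ, E) 𝓘(ℝ, K) ∞ (fun y ↦ φ.symm (e.symm (ρ y))) (j q) :=
    hφsm.comp (j q) ((contMDiffAt_iff_contDiffAt.2 hesm).comp (j q) hρx)
  have hτq : φ.symm (e.symm (ρ (j q))) = q := by rw [hsymm, hl]
  refine ⟨fun y ↦ φ.symm (e.symm (ρ y)), hτ, ?_⟩
  have hjτ : ContinuousAt (fun y ↦ j (φ.symm (e.symm (ρ y)))) (j q) :=
    (hj.contMDiff.continuous.continuousAt).comp hτ.continuousAt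
  filter_upwards [hWo.mem_nhds hxW, hρx.continuousAt (e.open_target.mem_nhds het),
    hjτ (hWo.mem_nhds (hτq.symm ▸ hxW : j (φ.symm (e.symm (ρ (j q)))) ∈ W))] with y hyW hye hyj hfy
  -- Both `y` and `j (τ y)` lie in the fiber of `f (j q)` and have the same `ρ`, which is injective
  -- on that fiber inside `W`.
  have h1 : ρ (j (φ.symm (e.symm (ρ y)))) = ρ y := e.right_inv hye
  have h2 := (hWp _ hyj (apply_eq_of_isIntegralManifold hf hj _ q)).2
  rw [h1, (hWp y hyW hfy).2] at h2
  exact h2.symm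

end Leaf

lemma deriv_deriv_comp {E K : Type*} [NormedAddCommGroup E] [NormedSpace ℝ E]
    [NormedAddCommGroup K] [NormedSpace ℝ K] {i : K → E} {s : ℝ → K} {c : ℝ → E} {t : ℝ}
    (hi : ContDiffAt ℝ ∞ i (s t)) (hs : ContDiffAt ℝ ∞ s t) (hc : c =ᶠ[𝓝 t] i ∘ s) :
    deriv c t = fderiv ℝ i (s t) (deriv s t) ∧
      deriv (deriv c) t = fderiv ℝ (fderiv ℝ i) (s t) (deriv s t) (deriv s t) +
        fderiv ℝ i (s t) (deriv (deriv s) t) := by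
  have h1 : ∀ᶠ r in 𝓝 t, deriv c r = fderiv ℝ i (s r) (deriv s r) := by
    filter_upwards [hc.eventuallyEq_nhds,
      hs.continuousAt.eventually ((hi.of_le two_le_infty).eventually (by simp)),
      (hs.of_le two_le_infty).eventually (by simp)] with r hr hir hsr
    rw [hr.deriv_eq]
    exact (((hir.differentiableAt (by simp)).hasFDerivAt).comp_hasDerivAt r
      (hsr.differentiableAt (by simp)).hasDerivAt).deriv
  refine ⟨h1.self_of_nhds, ?_⟩
  rw [EventuallyEq.deriv_eq h1]
  have h2 : HasDerivAt (fun r ↦ fderiv ℝ i (s r)) (fderiv ℝ (fderiv ℝ i) (s t) (deriv s t)) t :=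
    (((hi.fderiv_right (m := 1) (by norm_cast)).differentiableAt
      (by simp)).hasFDerivAt).comp_hasDerivAt t (hs.differentiableAt (by simp)).hasDerivAt
  have h3 : HasDerivAt (deriv s) (deriv (deriv s) t) t := by
    have : ContDiffAt ℝ 1 (deriv s) t := by
      have h4 := hs.fderiv_right (m := 1) (by norm_cast)
      exact h4.clm_apply (contDiffAt_const (c := (1 : ℝ)))
    exact (this.differentiableAt (by simp)).hasDerivAt
  exact (h2.clm_apply h3).deriv

/-! ### Geodesics of the induced metric -/

section Geodesic

variable {E : Type*} [NormedAddCommGroup E] [NormedSpace ℝ E] [FiniteDimensional ℝ E]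
  {M : Type u} [TopologicalSpace M] [ChartedSpace E M] [IsManifold 𝓘(ℝ, E) ∞ M]
  {K : Type*} [NormedAddCommGroup K] [NormedSpace ℝ K] [FiniteDimensional ℝ K]
  {L : Type u} [TopologicalSpace L] [ChartedSpace K L] [IsManifold 𝓘(ℝ, K) ∞ L]
  (g : Bundle.ContMDiffRiemannianMetric 𝓘(ℝ, E) ∞ E (fun x : M ↦ TangentSpace 𝓘(ℝ, E) x))

/-- A curve in an immersed submanifold that is a geodesic of the ambient manifold is a geodesic of
the induced metric. -/
lemma isGeodesic_of_isGeodesic_comp {j : L → M} (hj : ContMDiff 𝓘(ℝ, K) 𝓘(ℝ, E) ∞ j)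
    (hinj : ∀ q, Function.Injective (mfderiv 𝓘(ℝ, K) 𝓘(ℝ, E) j q)) {σ : ℝ → L}
    (hσ : ContMDiff 𝓘(ℝ, ℝ) 𝓘(ℝ, K) ∞ σ) (hγ : IsGeodesic g.inner (j ∘ σ)) :
    IsGeodesic (inducedMetric K g.inner j) σ := by
  refine ⟨hσ, fun q₀ t ht ↦ ?_⟩
  set s : ℝ → K := fun r ↦ extChartAt 𝓘(ℝ, K) q₀ (σ r) with hs
  set x₀ := j (σ t) with hx₀
  set i : K → E := inCharts q₀ x₀ j with hi
  have hy : s t ∈ (extChartAt 𝓘(ℝ, K) q₀).target := (extChartAt 𝓘(ℝ, K) q₀).map_source ht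
  have hyσ : (extChartAt 𝓘(ℝ, K) q₀).symm (s t) = σ t := (extChartAt 𝓘(ℝ, K) q₀).left_inv ht
  have hjy : j ((extChartAt 𝓘(ℝ, K) q₀).symm (s t)) ∈ (extChartAt 𝓘(ℝ, E) x₀).source := by
    rw [hyσ]; exact mem_extChartAt_source (I := 𝓘(ℝ, E)) x₀
  have hit : i (s t) ∈ (extChartAt 𝓘(ℝ, E) x₀).target := (extChartAt 𝓘(ℝ, E) x₀).map_source hjy
  have hc : (fun r ↦ extChartAt 𝓘(ℝ, E) x₀ ((j ∘ σ) r)) =ᶠ[𝓝 t] i ∘ s := by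
    filter_upwards [hσ.continuous.continuousAt ((isOpen_extChartAt_source q₀).mem_nhds ht)]
      with r hr
    exact congrArg (fun a ↦ extChartAt 𝓘(ℝ, E) x₀ (j a)) ((extChartAt 𝓘(ℝ, K) q₀).left_inv hr).symm
  obtain ⟨h1, h2⟩ := deriv_deriv_comp (contDiffAt_inCharts hy hj.contMDiffAt hjy)
    (contDiffAt_extChartAt_comp hσ ht) hc
  have h3 := hγ.equation x₀ t (mem_extChartAt_source (I := 𝓘(ℝ, E)) x₀)
  rw [h1, h2, show extChartAt 𝓘(ℝ, E) x₀ ((j ∘ σ) t) = i (s t) from hc.self_of_nhds] at h3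
  have hDi : ∀ v, fderiv ℝ i (s t) v = 0 → v = 0 := by
    intro v hv
    rw [hi, fderiv_inCharts hy hj.contMDiffAt hjy] at hv
    have h4 := (map_eq_zero_iff _ (mfderiv_extChartAt_injective hjy)).1 hv
    have h5 := (map_eq_zero_iff _ (hinj _)).1 h4
    exact (map_eq_zero_iff _ (mfderiv_extChartAt_symm_injective hy)).1 h5
  have hform := formInChart_inducedMetric g.inner hy hj.contMDiffAt hjy
  have hpos : ∀ v, v ≠ 0 → 0 < formInChart (inducedMetric K g.inner j) q₀ (s t) v v := by
    intro v hv
    rw [hform, pullbackForm_apply]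
    exact formInChart_pos g hit fun h ↦ hv (hDi v h)
  -- By the Gauss formula, pairing the intrinsic acceleration with `w` equals pairing the ambient
  -- acceleration, which is zero, with `Di w`.
  have hzero : ∀ w, formInChart (inducedMetric K g.inner j) q₀ (s t) (deriv (deriv s) t +
      christoffel (inducedMetric K g.inner j) q₀ (s t) (deriv s t) (deriv s t)) w = 0 := by
    intro w
    rw [map_add, formInChart_christoffel (isInvertible_of_pos hpos), add_apply,
      christoffelFirst_inducedMetric g hy hj hjy, hform, pullbackForm_apply, ← add_apply,
      ← map_add]
    have h4 := congrArg (fun a ↦ formInChart g.inner x₀ (i (s t)) a (fderiv ℝ i (s t) w)) h3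
    simp only [map_zero, zero_apply] at h4
    rw [← h4]
    congr 2
    rw [← add_assoc, add_comm (fderiv ℝ i (s t) _)]
  by_contra hne
  exact (hpos _ hne).ne' (hzero _)

end Geodesic

/-! ### Completeness of the leaves -/

section Main

variable {E : Type*} [NormedAddCommGroup E] [NormedSpace ℝ E] [FiniteDimensional ℝ E]
  {M : Type u} [TopologicalSpace M] [ChartedSpace E M] [IsManifold 𝓘(ℝ, E) ∞ M]
  {F : Type*} [NormedAddCommGroup F] [NormedSpace ℝ F] [FiniteDimensional ℝ F]
  {N : Type v} [TopologicalSpace N] [ChartedSpace F N] [IsManifold 𝓘(ℝ, F) ∞ N]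
  {K : Type*} [NormedAddCommGroup K] [NormedSpace ℝ K] [FiniteDimensional ℝ K]
  {L : Type u} [TopologicalSpace L] [ChartedSpace K L] [IsManifold 𝓘(ℝ, K) ∞ L]

/-- The maximal integral manifolds of an autoparallel distribution `ker (df)` on the set of points
of maximal rank are complete. -/
theorem isCompleteMetric_inducedMetric
    (g : Bundle.ContMDiffRiemannianMetric 𝓘(ℝ, E) ∞ E (fun x : M ↦ TangentSpace 𝓘(ℝ, E) x))
    (hcomplete : IsCompleteMetric g.inner) {f : M → N} (hf : ContMDiff 𝓘(ℝ, E) 𝓘(ℝ, F) ∞ f)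
    (hauto : IsAutoparallelOn g.inner (kerDistribution E F f) (maxRankSet E F f)) {j : L → M}
    (hj : IsMaximalIntegralManifold K (kerDistribution E F f) (maxRankSet E F f) j) :
    IsCompleteMetric (inducedMetric K g.inner j) := by
  rintro ⟨q, w⟩
  obtain ⟨γ, hγ, hv⟩ := hcomplete ⟨j q, mfderiv 𝓘(ℝ, K) 𝓘(ℝ, E) j q w⟩
  have hγ0 : γ 0 = j q := congrArg (fun p : TangentBundle 𝓘(ℝ, E) M ↦ p.1) hv
  let A : ℝ →L[ℝ] E := mfderiv 𝓘(ℝ, ℝ) 𝓘(ℝ, E) γ 0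
  have hγ1 : A 1 = mfderiv 𝓘(ℝ, K) 𝓘(ℝ, E) j q w :=
    congrArg (fun p : TangentBundle 𝓘(ℝ, E) M ↦ (p.2 : E)) hv
  have hfγ0 : mfderiv 𝓘(ℝ, ℝ) 𝓘(ℝ, F) (f ∘ γ) 0 = 0 := by
    rw [mfderiv_curve_eq_zero_iff, mfderiv_comp 0 (hf.contMDiffAt.mdifferentiableAt (by simp))
      (hγ.contMDiff.contMDiffAt.mdifferentiableAt (by simp))]
    let D : M → E →L[ℝ] F := fun x ↦ mfderiv 𝓘(ℝ, E) 𝓘(ℝ, F) f x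
    change D (γ 0) (A 1) = 0
    rw [hγ0, hγ1]
    exact mfderiv_apply_mfderiv_of_isIntegralManifold hj.1 q w
  have hγU := mem_maxRankSet_of_isGeodesic g hf hauto hγ (hγ0 ▸ hj.1.mem q) hfγ0
  have hfγ : ∀ t, f (γ t) = f (j q) := fun t ↦ hγ0 ▸
    eq_of_mfderiv_eq_zero (hf.comp hγ.contMDiff) (fun t ↦ (hγU t).2) t 0
  have hrange : ∀ t, γ t ∈ range j := by
    intro t
    rw [range_eq_connectedComponentIn hf hj q]
    refine (isPreconnected_range hγ.contMDiff.continuous).subset_connectedComponentIn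
      ⟨0, hγ0⟩ ?_ (mem_range_self t)
    rintro _ ⟨t, rfl⟩
    exact ⟨(hγU t).1, hfγ t⟩
  choose σ hσ using hrange
  have hσγ : j ∘ σ = γ := funext hσ
  -- Near `t` the lift is `τ ∘ γ`: `γ` stays in one fiber, where `j ∘ τ` is the identity, and `j` is
  -- injective.
  have hσsm : ContMDiff 𝓘(ℝ, ℝ) 𝓘(ℝ, K) ∞ σ := by
    intro t
    obtain ⟨τ, hτ, hjτ⟩ := exists_local_inverse hf hj.1 (σ t)
    rw [hσ t] at hτ hjτ
    refine (hτ.comp t hγ.contMDiff.contMDiffAt).congr_of_eventuallyEq ?_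
    filter_upwards [hγ.contMDiff.continuous.continuousAt.eventually hjτ] with r hr
    exact hj.1.injective ((hσ r).trans (hr ((hfγ r).trans (hfγ t).symm)).symm)
  obtain rfl : σ 0 = q := hj.1.injective ((hσ 0).trans hγ0)
  refine ⟨σ, isGeodesic_of_isGeodesic_comp g hj.1.contMDiff hj.1.injective_mfderiv hσsm
    (hσγ ▸ hγ), ?_⟩
  have h1 : mfderiv 𝓘(ℝ, ℝ) 𝓘(ℝ, K) σ 0 (1 : ℝ) = w := by
    refine hj.1.injective_mfderiv (σ 0) (Eq.trans ?_ hγ1)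
    have h2 : mfderiv 𝓘(ℝ, ℝ) 𝓘(ℝ, E) (j ∘ σ) 0 = _ :=
      mfderiv_comp 0 (hj.1.contMDiff.contMDiffAt.mdifferentiableAt (by simp))
        (hσsm.contMDiffAt.mdifferentiableAt (by simp))
    have h3 : ∀ γ' : ℝ → M, γ' = γ →
        (mfderiv 𝓘(ℝ, ℝ) 𝓘(ℝ, E) γ' 0 : ℝ →L[ℝ] E) 1 = A 1 := by
      rintro _ rfl; rfl
    exact (DFunLike.congr_fun h2 (1 : ℝ)).symm.trans (h3 _ hσγ)
  exact congrArg (Bundle.TotalSpace.mk (σ 0)) h1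

end Main

end KernelFoliation

end

theorem mainTheorem1 {m n k : ℕ}
    {M : Type u} [TopologicalSpace M] [T2Space M] [ChartedSpace (EuclideanSpace ℝ (Fin m)) M]
    [IsManifold (𝓡 m) ∞ M]
    (g : Bundle.ContMDiffRiemannianMetric (𝓡 m) ∞ (EuclideanSpace ℝ (Fin m))
      (fun x : M ↦ TangentSpace (𝓡 m) x))
    (hcomplete : KernelFoliation.IsCompleteMetric g.inner)
    {N : Type v} [TopologicalSpace N] [T2Space N] [ChartedSpace (EuclideanSpace ℝ (Fin n)) N]
    [IsManifold (𝓡 n) ∞ N]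
    (f : M → N) (hf : ContMDiff (𝓡 m) (𝓡 n) ∞ f)
    (U : Set M)
    (hU : U = KernelFoliation.maxRankSet (EuclideanSpace ℝ (Fin m)) (EuclideanSpace ℝ (Fin n)) f)
    (hauto : KernelFoliation.IsAutoparallelOn g.inner
      (KernelFoliation.kerDistribution (EuclideanSpace ℝ (Fin m)) (EuclideanSpace ℝ (Fin n)) f) U)
    {L : Type u} [TopologicalSpace L] [ChartedSpace (EuclideanSpace ℝ (Fin k)) L]
    [IsManifold (𝓡 k) ∞ L]
    (j : L → M)
    (hj : KernelFoliation.IsMaximalIntegralManifold (EuclideanSpace ℝ (Fin k))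
      (KernelFoliation.kerDistribution (EuclideanSpace ℝ (Fin m)) (EuclideanSpace ℝ (Fin n)) f)
      U j) :
    KernelFoliation.IsCompleteMetric
      (KernelFoliation.inducedMetric (EuclideanSpace ℝ (Fin k)) g.inner j) := by
  subst hU
  exact KernelFoliation.isCompleteMetric_inducedMetric g hcomplete hf hauto hj
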